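/- **Definitions.** Graphs are finite, simple and undirected, on the vertex set $V=[n]$. For a graph $H$ and $\emptyset\ne S\subsetneq V(H)$, the volume $\mathrm{vol}_H(S)$ is the sum of the degrees in $H$ of the vertices in $S$, and the sparsity of the cut $S$ is $\Phi_H(S)=|E_H(S,V(H)\setminus S)|/\min\{\mathrm{vol}_H(S),\mathrm{vol}_H(V(H)\setminus S)\}$, where $0/0$ is read as $0$. $H$ is a $\phi$-expander if $\Phi_H(S)\ge\phi$ for all such $S$ (so a one-vertex graph is an expander). A partition $\mathcal U$ of $V$ into nonempty clusters is an $(\epsilon,\phi)$-expander decomposition (ED) of $G=(V,E)$ if $\frac12\sum_{U\in\mathcal U}|E(U,V\setminus U)|\le\epsilon|E|$ and the induced subgraph $G[U]$ is a $\phi$-expander for every $U\in\mathcal U$. Write $G\setminus\mathcal U$ for the graph on $V$ whose edges are the edges of $G$ not contained in a cluster of $\mathcal U$. A sequence $\mathcal U_1,\dots,\mathcal U_\ell$ of partitions of $V$ is an $\ell$-level removal-based $(\epsilon,\phi)$-ED sequence ($\ell$-level $(\epsilon,\phi)$-RED) of $G$ if, with $G_1=G$ and $G_{i+1}=G_i\setminus\mathcal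 U_i$, the partition $\mathcal U_i$ is an $(\epsilon,\phi)$-ED of $G_i$ for every $i\in\{1,\dots,\ell\}$. A (randomized, single-pass) streaming algorithm with $L$ bits of space on $n$-vertex graph streams reads a sequence of edge updates one at a time, keeping only a memory content in $\{0,1\}^L$; its random bits are free, its computation is unrestricted and may depend on $n,\ell,\epsilon,\phi$, and its output is a function of the final memory content and the random bits. It *computes an $\ell$-level $(\epsilon,\phi)$-RED with probability at least $9/10$* if, for every graph $G$ on $[n]$ and every insertion-only stream that inserts each edge of $G$ exactly once, in any order, its output is an $\ell$-level $(\epsilon,\phi)$-RED of $G$ with probability at least $9/10$. (Algorithms for dynamic streams, with insertions and deletions, are a special case.) **Theorem 3.** (1) There is an absolute constant $C>0$ such that for every $\delta>0$ there is a constant $c>0$ with the following property. Let $n\ge1$, $\ell\ge2$ and $\epsilon,\phi\in(0,1)$ satisfy $\epsilon\le1-\delta$, $\phi\le\epsilon$ and $\phi\ge C\cdot\max\{\epsilon^2,1/n\}$. Then any streaming algorithm that computes an $\ell$-level $(\epsilon,\phi)$-RED with probability at least $9/10$ uses at least $c\cdot n/\epsilon$ bits of space. (2) In particular, for near-optimal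 parameters, that is $\epsilon=\tilde O(\phi)$ and $1/n\ll\phi\ll1/\log n$, the space is $\tilde\Omega(n/\phi)$ bits: for every integer $a\ge0$ there is an integer $b\ge0$ such that for all $\delta,K>0$ there are constants $C,c>0$ such that, whenever $n\ge2$, $\ell\ge2$ and $\epsilon,\phi\in(0,1)$ satisfy $\epsilon\le1-\delta$, $\epsilon\le K\phi\log^a n$ and $C/n\le\phi\le1/(C\log n)$, any such algorithm uses at least $c\cdot n/(\phi\log^b n)$ bits of space. -/

import Mathlib

open scoped BigOperators

noncomputable section

/-! ## Cuts, volumes, expanders -/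

section Expanders

variable {V : Type} [Fintype V]

open Classical in
/-- The number of edges of `G` with one endpoint in `A` and the other in `B`
(used for disjoint `A`, `B` only). -/
def cutSize (G : SimpleGraph V) (A B : Finset V) : ℕ :=
  (G.interedges A B).card

open Classical in
/-- The volume of `S` in `G`: the sum of the degrees in `G` of the vertices of `S`. -/
def graphVolume (G : SimpleGraph V) (S : Finset V) : ℕ :=
  ∑ v ∈ S, G.degree v

open Classical in
/-- The number of edges of `G`. -/
def edgeCount (G : SimpleGraph V) : ℕ :=
  G.edgeFinset.card

open Classical in
/-- The sparsity of the cut `S` in `G`. When one side has volume zero the cut has no edges, and its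
sparsity is `0 / 0 = 0`: such a cut (an isolated set of vertices) is sparse. -/
def cutSparsity (G : SimpleGraph V) (S : Finset V) : ℝ :=
  (cutSize G S Sᶜ : ℝ) / min (graphVolume G S : ℝ) (graphVolume G Sᶜ : ℝ)

/-- `G` is a `ψ`-expander: every cut `∅ ≠ S ⊊ V` has sparsity at least `ψ`. (A graph on a single
vertex has no such cut, and is an expander.) -/
def IsExpander (G : SimpleGraph V) (ψ : ℝ) : Prop :=
  ∀ S : Finset V, S.Nonempty → S ≠ Finset.univ → ψ ≤ cutSparsity G S

end Expanders

/-! ## Expander decompositions and removal-based sequences of them -/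

/-- Partitions of the vertex set `[n]` into nonempty clusters. -/
abbrev VertexPartition (n : ℕ) : Type := Finpartition (Finset.univ : Finset (Fin n))

/-- `P` is an `(ε, φ)`-expander decomposition of `G`. -/
structure IsExpanderDecomposition {n : ℕ} (G : SimpleGraph (Fin n)) (ε φ : ℝ)
    (P : VertexPartition n) : Prop where
  /-- at most `ε |E|` edges run between clusters -/
  crossing : (1 / 2 : ℝ) * ∑ U ∈ P.parts, (cutSize G U Uᶜ : ℝ) ≤ ε * edgeCount G
  /-- every cluster induces a `φ`-expander -/
  expander : ∀ U ∈ P.parts, IsExpander (G.induce (U : Set (Fin n))) φ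

/-- The graph `G ∖ P`: the edges of `G` inside the clusters of `P` are removed, the vertex set is
kept. -/
def removeIntraCluster {n : ℕ} (G : SimpleGraph (Fin n)) (P : VertexPartition n) :
    SimpleGraph (Fin n) where
  Adj u v := G.Adj u v ∧ ¬ ∃ U ∈ P.parts, u ∈ U ∧ v ∈ U
  symm := ⟨fun _ _ h => ⟨h.1.symm, fun ⟨U, hU, hv, hu⟩ => h.2 ⟨U, hU, hu, hv⟩⟩⟩
  loopless := ⟨fun _ h => h.1.ne rfl⟩

/-- The graph left after the first `i` partitions of the sequence have been removed, for `i ≤ ℓ`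
(from `i = ℓ` on the graph does not change). -/
def residualGraph {n ℓ : ℕ} (G : SimpleGraph (Fin n)) (P : Fin ℓ → VertexPartition n) :
    ℕ → SimpleGraph (Fin n)
  | 0 => G
  | i + 1 =>
      if h : i < ℓ then removeIntraCluster (residualGraph G P i) (P ⟨i, h⟩)
      else residualGraph G P i

/-- `P` is an `ℓ`-level removal-based `(ε, φ)`-expander decomposition sequence of `G`. -/
def IsRED {n ℓ : ℕ} (G : SimpleGraph (Fin n)) (ε φ : ℝ) (P : Fin ℓ → VertexPartition n) : Prop :=
  ∀ i : Fin ℓ, IsExpanderDecomposition (residualGraph G P i) ε φ (P i)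

/-! ## Randomized single-pass streaming algorithms -/

/-- One element of a graph stream on the vertex set `[n]`: the insertion or the deletion of a
pair. -/
inductive EdgeUpdate (n : ℕ) : Type
  | insertion (e : Sym2 (Fin n)) : EdgeUpdate n
  | deletion (e : Sym2 (Fin n)) : EdgeUpdate n

/-- A randomized single-pass streaming algorithm on `n`-vertex graph streams with `L` bits of
memory that outputs `ℓ` partitions of the vertex set. `Ω` is the sample space of its random bits.
The only information about the stream that survives from one update to the next is the memory
content in `{0,1}^L`. Computation is not restricted, the algorithm may depend on `n` (and on all
parameters), and the random bits, a step counter (so that fresh random bits can be used at each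
update) and the output are not charged for. -/
structure StreamingAlgorithm (n ℓ L : ℕ) (Ω : Type) [MeasurableSpace Ω] where
  /-- the memory before the stream starts -/
  init : Ω → (Fin L → Bool)
  /-- the new memory, from the random bits, the number of updates read before, the memory, and the
  current update -/
  step : Ω → ℕ → (Fin L → Bool) → EdgeUpdate n → (Fin L → Bool)
  /-- the output at the end of the stream -/
  output : Ω → (Fin L → Bool) → (Fin ℓ → VertexPartition n)
  init_measurable : ∀ s, MeasurableSet {ω | init ω = s}
  step_measurable : ∀ t s u s', MeasurableSet {ω | step ω t s u = s'}
  output_measurable : ∀ s P, MeasurableSet {ω | output ω s = P}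

namespace StreamingAlgorithm

variable {n ℓ L : ℕ} {Ω : Type} [MeasurableSpace Ω]

/-- The memory after a list of updates, starting with memory `s` after `t` updates. -/
def runFrom (A : StreamingAlgorithm n ℓ L Ω) (ω : Ω) :
    ℕ → (Fin L → Bool) → List (EdgeUpdate n) → (Fin L → Bool)
  | _, s, [] => s
  | t, s, u :: us => A.runFrom ω (t + 1) (A.step ω t s u) us

/-- The output of the algorithm on a stream, with random bits `ω`. -/
def result (A : StreamingAlgorithm n ℓ L Ω) (ω : Ω) (stream : List (EdgeUpdate n)) :
    Fin ℓ → VertexPartition n :=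
  A.output ω (A.runFrom ω 0 (A.init ω) stream)

/-- On every insertion-only stream, which inserts every edge of a graph `G` once in some order,
the output is with probability at least `9/10` an `ℓ`-level `(ε, φ)`-RED of `G`. Nothing is asked
on streams with deletions, so this holds for every algorithm that is correct on dynamic streams,
and for every insertion-only algorithm. -/
def ComputesRED (A : StreamingAlgorithm n ℓ L Ω) (μ : MeasureTheory.Measure Ω) (ε φ : ℝ) : Prop :=
  ∀ (G : SimpleGraph (Fin n)) (es : List (Sym2 (Fin n))),
    es.Nodup → (∀ e, e ∈ es ↔ e ∈ G.edgeSet) →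
      (9 / 10 : ℝ) ≤ μ.real {ω | IsRED G ε φ (A.result ω (es.map EdgeUpdate.insertion))}

end StreamingAlgorithm

/-- Some streaming algorithm with `L` bits of memory computes, with probability at least `9/10`,
an `ℓ`-level `(ε, φ)`-RED of every `n`-vertex graph given in an insertion-only stream. -/
def REDComputableWithBits (n ℓ L : ℕ) (ε φ : ℝ) : Prop :=
  ∃ (Ω : Type) (_ : MeasurableSpace Ω) (μ : MeasureTheory.Measure Ω)
    (_ : MeasureTheory.IsProbabilityMeasure μ) (A : StreamingAlgorithm n ℓ L Ω),
    A.ComputesRED μ ε φ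

end

/-!
Both bounds are one-way communication arguments: a graph stream starts with edges that encode bits,
and a decoder that only sees the memory recovers many of the bits.

For the bound `n / ε`, take `k ≈ 1 / ε` and about `n / k` blocks, each with `2k` rows and `k`
columns. Each bit `(i, a, b)` decides to which of the two rows with number `a` the column `b` of block
`i` is joined, so there are about `n k ≈ n / ε` bits. The decoder chooses a number `j` and continues
the stream: one row with number `j` in each block, together with extra vertices (anchors), is
completely joined to a hub `Y` of size about `1 / φ`, and all other rows are completely joined to a
hub `X` of the same size. The edges between the selected rows and the columns then form a cut of
sparsity below `φ`, so a `φ`-expanding cluster cannot contain most of both hubs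
(`GadgetVertex.cluster_hubX_ne_cluster_hubY`). As few edges run between clusters, almost all selected
rows are in the cluster of `Y`, and almost all other rows and columns are in the cluster of `X`. Hence
the graph of the second level consists, up to few exceptions, of stars that join each selected row to
its neighbouring columns, all other columns being isolated. Clusters are connected and few star edges
are cut, so the clusters of the second level reveal the neighbours of the selected rows, that is,
almost all bits with number `j` (`GadgetVertex.card_decodeBit_ne_le`). The assumption `φ ≥ C ε²` is
what makes the exceptional edges, of which there may be an `ε` fraction at each level, negligible
compared with the star edges. Since this works for every `j`, the memory determines all the bits up to
a small Hamming distance (`card_le_of_average_errors`).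

For near-optimal parameters, either `φ ≥ C ε²` holds after raising `ε` to `max ε φ`, and the first
bound applies, or `φ` is at least an inverse power of `log n`, so that up to logarithmic factors a
bound linear in `n` is enough. The latter holds because the first-level clusters of a matching
contain a `δ` fraction of its edges (`matching_bits_le_of_computable`).
-/

/-! ### Edges between clusters -/

section Crossing

variable {n : ℕ} {G : SimpleGraph (Fin n)} {P : VertexPartition n} {ε φ : ℝ}

open Classical in
/-- The ordered pairs of adjacent vertices that lie in different clusters of `P`; every edge between
clusters is counted twice. -/
noncomputable def crossingPairs (G : SimpleGraph (Fin n)) (P : VertexPartition n) :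
    Finset (Fin n × Fin n) :=
  Finset.univ.filter fun p => G.Adj p.1 p.2 ∧ P.part p.1 ≠ P.part p.2

theorem mem_crossingPairs {p : Fin n × Fin n} :
    p ∈ crossingPairs G P ↔ G.Adj p.1 p.2 ∧ P.part p.1 ≠ P.part p.2 := by
  simp [crossingPairs]

theorem sum_cutSize_eq_card_crossingPairs (G : SimpleGraph (Fin n)) (P : VertexPartition n) :
    ∑ U ∈ P.parts, cutSize G U Uᶜ = (crossingPairs G P).card := by
  classical
  rw [Finset.card_eq_sum_card_fiberwise (f := fun p => P.part p.1) (t := P.parts)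
    (fun p _ => P.part_mem.2 (Finset.mem_univ _))]
  refine Finset.sum_congr rfl fun U hU => ?_
  unfold cutSize
  congr 1
  ext p
  simp only [SimpleGraph.mem_interedges_iff, Finset.mem_compl, Finset.mem_filter,
    mem_crossingPairs, ← P.part_eq_iff_mem hU]
  constructor
  · rintro ⟨h1, h2, h3⟩
    exact ⟨⟨h3, by rw [h1]; exact fun h => h2 h.symm⟩, h1⟩
  · rintro ⟨⟨h1, h2⟩, h3⟩
    exact ⟨h3, fun h => h2 (h3.trans h.symm), h1⟩

theorem removeIntraCluster_adj {u v : Fin n} :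
    (removeIntraCluster G P).Adj u v ↔ G.Adj u v ∧ P.part u ≠ P.part v := by
  have : (∃ U ∈ P.parts, u ∈ U ∧ v ∈ U) ↔ P.part u = P.part v := by
    rw [← P.mem_part_iff_part_eq_part (Finset.mem_univ _) (Finset.mem_univ _),
      P.mem_part_iff_exists]
  change G.Adj u v ∧ ¬ _ ↔ _
  rw [this]

theorem two_mul_edgeCount_removeIntraCluster :
    2 * edgeCount (removeIntraCluster G P) = (crossingPairs G P).card := by
  classical
  unfold edgeCount
  rw [SimpleGraph.two_mul_card_edgeFinset]
  congr 1
  ext p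
  simp [mem_crossingPairs, removeIntraCluster_adj]

theorem IsExpanderDecomposition.card_crossingPairs_le (h : IsExpanderDecomposition G ε φ P) :
    ((crossingPairs G P).card : ℝ) ≤ 2 * ε * edgeCount G := by
  have := h.crossing
  rw [← Nat.cast_sum, sum_cutSize_eq_card_crossingPairs] at this
  linarith

end Crossing

/-! ### Cuts of expanding clusters -/

section ExpanderCuts

open Classical in
theorem graphVolume_eq_card {V : Type} [Fintype V] (G : SimpleGraph V) (S : Finset V) :
    graphVolume G S = (Finset.univ.filter fun p : V × V => p.1 ∈ S ∧ G.Adj p.1 p.2).card := by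
  unfold graphVolume
  rw [Finset.card_eq_sum_card_fiberwise (f := Prod.fst) (t := S)
    (fun p hp => by simpa using (Finset.mem_filter.1 hp).2.1)]
  refine Finset.sum_congr rfl fun v hv => ?_
  rw [← SimpleGraph.card_neighborFinset_eq_degree]
  refine Finset.card_nbij' (fun w => (v, w)) Prod.snd ?_ ?_ ?_ ?_
  · intro w hw
    simpa [hv] using hw
  · rintro ⟨a, b⟩ hp
    obtain ⟨⟨-, h⟩, rfl⟩ : (a ∈ S ∧ G.Adj a b) ∧ a = v := by simpa using hp
    simpa using h
  · intro w _
    rfl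
  · rintro ⟨a, b⟩ hp
    obtain ⟨-, rfl⟩ : (a ∈ S ∧ G.Adj a b) ∧ a = v := by simpa using hp
    rfl

open Classical in
/-- The expansion inequality, in terms of ordered pairs of adjacent vertices: the sides of the cut
are the vertices with and without the property `p`. -/
theorem IsExpander.cut_of_pred {V : Type} [Fintype V] {G : SimpleGraph V} {φ : ℝ}
    (h : IsExpander G φ) (hφ : 0 < φ) (p : V → Prop) (hp : ∃ u, p u) (hp' : ∃ u, ¬ p u) :
    φ * min ((Finset.univ.filter fun e : V × V => p e.1 ∧ G.Adj e.1 e.2).card : ℝ)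
        (Finset.univ.filter fun e : V × V => ¬ p e.1 ∧ G.Adj e.1 e.2).card ≤
      (Finset.univ.filter fun e : V × V => p e.1 ∧ ¬ p e.2 ∧ G.Adj e.1 e.2).card ∧
    0 < (Finset.univ.filter fun e : V × V => p e.1 ∧ ¬ p e.2 ∧ G.Adj e.1 e.2).card := by
  obtain ⟨u, hu⟩ := hp
  obtain ⟨v, hv⟩ := hp'
  have key := h (Finset.univ.filter p) ⟨u, by simp [hu]⟩
    (fun hh => hv (by simpa using Finset.ext_iff.1 hh v))
  have hc : cutSize G (Finset.univ.filter p) (Finset.univ.filter p)ᶜ =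
      (Finset.univ.filter fun e : V × V => p e.1 ∧ ¬ p e.2 ∧ G.Adj e.1 e.2).card := by
    unfold cutSize
    congr 1
    ext e
    simp [SimpleGraph.mem_interedges_iff]
  unfold cutSparsity at key
  rw [graphVolume_eq_card, graphVolume_eq_card, hc] at key
  simp only [Finset.mem_filter, Finset.mem_univ, true_and, Finset.mem_compl] at key
  set c := (Finset.univ.filter fun e : V × V => p e.1 ∧ ¬ p e.2 ∧ G.Adj e.1 e.2).card
  set m : ℝ := min ((Finset.univ.filter fun e : V × V => p e.1 ∧ G.Adj e.1 e.2).card : ℝ)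
        (Finset.univ.filter fun e : V × V => ¬ p e.1 ∧ G.Adj e.1 e.2).card
  have hm0 : 0 ≤ m := le_min (Nat.cast_nonneg _) (Nat.cast_nonneg _)
  -- A cut of volume zero has sparsity `0 / 0 = 0 < φ`, so the volume is positive.
  have hm : 0 < m := by
    rcases hm0.eq_or_lt with h0 | h0
    · rw [← h0, div_zero] at key
      linarith
    · exact h0
  have hc : φ * m ≤ c := (le_div_iff₀ hm).1 key
  refine ⟨hc, ?_⟩
  have : (0 : ℝ) < c := (mul_pos hφ hm).trans_le hc
  exact_mod_cast this

/-- The expansion inequality of a cluster `U` of `G`, with the volumes bounded below and the cut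
bounded above by numbers of ordered pairs of vertices of `G`. -/
theorem IsExpander.cut_induce {n : ℕ} {G : SimpleGraph (Fin n)} {U : Finset (Fin n)} {φ : ℝ}
    (h : IsExpander (G.induce (U : Set (Fin n))) φ) (hφ : 0 < φ) (p : Fin n → Prop)
    {u v : Fin n} (hu : u ∈ U) (hpu : p u) (hv : v ∈ U) (hpv : ¬ p v)
    (X Y Z : Finset (Fin n × Fin n))
    (hX : ∀ e ∈ X, e.1 ∈ U ∧ e.2 ∈ U ∧ p e.1 ∧ G.Adj e.1 e.2)
    (hY : ∀ e ∈ Y, e.1 ∈ U ∧ e.2 ∈ U ∧ ¬ p e.1 ∧ G.Adj e.1 e.2)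
    (hZ : ∀ a b, a ∈ U → b ∈ U → p a → ¬ p b → G.Adj a b → (a, b) ∈ Z) :
    φ * min (X.card : ℝ) Y.card ≤ Z.card ∧ 0 < Z.card := by
  classical
  obtain ⟨h1, h2⟩ := h.cut_of_pred hφ (fun a => p a.1) ⟨⟨u, hu⟩, hpu⟩ ⟨⟨v, hv⟩, hpv⟩
  have inj : ∀ (X : Finset (Fin n × Fin n)) (q : Fin n → Prop)
      (_ : ∀ e ∈ X, e.1 ∈ U ∧ e.2 ∈ U ∧ q e.1 ∧ G.Adj e.1 e.2),
      X.card ≤ (Finset.univ.filter fun e : ↥(U : Set (Fin n)) × ↥(U : Set (Fin n)) =>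
        q e.1.1 ∧ (G.induce (U : Set (Fin n))).Adj e.1 e.2).card := by
    intro X q hX
    rw [← Finset.card_attach]
    refine Finset.card_le_card_of_injOn
      (fun e => (⟨e.1.1, (hX e.1 e.2).1⟩, ⟨e.1.2, (hX e.1 e.2).2.1⟩)) ?_ ?_
    · intro e _
      exact Finset.mem_filter.2 ⟨Finset.mem_univ _, (hX e.1 e.2).2.2⟩
    · intro e _ e' _ hee
      have hee' := Prod.ext_iff.1 hee
      exact Subtype.ext (Prod.ext (congrArg Subtype.val hee'.1) (congrArg Subtype.val hee'.2))
  have hZc : (Finset.univ.filter fun e : ↥(U : Set (Fin n)) × ↥(U : Set (Fin n)) =>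
      p e.1.1 ∧ ¬ p e.2.1 ∧ (G.induce (U : Set (Fin n))).Adj e.1 e.2).card ≤ Z.card := by
    refine Finset.card_le_card_of_injOn (fun e => (e.1.1, e.2.1)) ?_ ?_
    · intro e he
      have he' := (Finset.mem_filter.1 he).2
      exact hZ _ _ e.1.2 e.2.2 he'.1 he'.2.1 he'.2.2
    · intro e _ e' _ hee
      have hee' := Prod.ext_iff.1 hee
      exact Prod.ext (Subtype.ext hee'.1) (Subtype.ext hee'.2)
  have hXc := inj X p hX
  have hYc := inj Y (fun a => ¬ p a) hY
  refine ⟨le_trans ?_ (h1.trans (Nat.cast_le.2 ?_)), h2.trans_le ?_⟩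
  · refine mul_le_mul_of_nonneg_left (min_le_min ?_ ?_) hφ.le
    · exact_mod_cast hXc
    · exact_mod_cast hYc
  · exact hZc
  · exact hZc

/-- The clusters of an expander decomposition are connected; in particular a vertex without
neighbours is a cluster of its own. -/
theorem IsExpanderDecomposition.part_ne_of_isolated {n : ℕ} {G : SimpleGraph (Fin n)}
    {P : VertexPartition n} {ε φ : ℝ} (h : IsExpanderDecomposition G ε φ P) (hφ : 0 < φ)
    {u v : Fin n} (huv : v ≠ u) (hiso : ∀ w, ¬ G.Adj u w) : P.part v ≠ P.part u := by
  intro heq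
  have hU : P.part u ∈ P.parts := P.part_mem.2 (Finset.mem_univ _)
  have := ((h.expander _ hU).cut_induce hφ (fun w => w = u) (u := u) (v := v)
    (P.mem_part (Finset.mem_univ _)) rfl (heq ▸ P.mem_part (Finset.mem_univ _)) huv
    ∅ ∅ ∅ (by simp) (by simp) (fun a b _ _ ha _ hab => (hiso b (ha ▸ hab)).elim)).2
  simp at this

end ExpanderCuts

/-! ### The first two levels -/

section Levels

variable {n ℓ : ℕ} {G : SimpleGraph (Fin n)} {ε φ : ℝ} {P : Fin ℓ → VertexPartition n}

theorem IsRED.first (h : IsRED G ε φ P) (hl : 0 < ℓ) :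
    IsExpanderDecomposition G ε φ (P ⟨0, hl⟩) :=
  h ⟨0, hl⟩

theorem IsRED.second (h : IsRED G ε φ P) (hl : 1 < ℓ) :
    IsExpanderDecomposition (removeIntraCluster G (P ⟨0, by omega⟩)) ε φ (P ⟨1, hl⟩) := by
  have := h ⟨1, hl⟩
  have h0 : 0 < ℓ := by omega
  simpa [residualGraph, h0] using this

theorem IsExpanderDecomposition.mono {P : VertexPartition n} {ε' φ' : ℝ}
    (h : IsExpanderDecomposition G ε φ P) (hε : ε ≤ ε') (hφ : φ' ≤ φ) :
    IsExpanderDecomposition G ε' φ' P where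
  crossing := h.crossing.trans (by gcongr)
  expander U hU S hS hS' := hφ.trans (h.expander U hU S hS hS')

theorem IsRED.mono {ε' φ' : ℝ} (h : IsRED G ε φ P) (hε : ε ≤ ε') (hφ : φ' ≤ φ) :
    IsRED G ε' φ' P :=
  fun i => (h i).mono hε hφ

end Levels

/-! ### Graphs given by edge lists -/

section EdgeLists

variable {n : ℕ}

/-- The graph whose edges are the entries of a list. -/
def graphOfList (es : List (Sym2 (Fin n))) : SimpleGraph (Fin n) :=
  SimpleGraph.fromEdgeSet {e | e ∈ es}

theorem mem_edgeSet_graphOfList {es : List (Sym2 (Fin n))} (h : ∀ e ∈ es, ¬ e.IsDiag)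
    (e : Sym2 (Fin n)) : e ∈ es ↔ e ∈ (graphOfList es).edgeSet := by
  simp only [graphOfList, SimpleGraph.edgeSet_fromEdgeSet, Set.mem_sdiff, Set.mem_ofPred_eq]
  exact ⟨fun he => ⟨he, h e he⟩, fun he => he.1⟩

theorem edgeCount_graphOfList_le (es : List (Sym2 (Fin n))) :
    edgeCount (graphOfList es) ≤ es.length := by
  classical
  unfold edgeCount
  refine le_trans (Finset.card_le_card (t := es.toFinset) ?_) (List.toFinset_card_le _)
  intro e he
  rw [SimpleGraph.mem_edgeFinset, graphOfList, SimpleGraph.edgeSet_fromEdgeSet] at he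
  simpa using he.1

end EdgeLists

/-! ### Clusterings of complete bipartite graphs -/

section Bipartite

variable {α β κ : Type} [DecidableEq κ] {f : α → κ} {g : β → κ}

/-- If a clustering cuts at most a quarter of the pairs of a complete bipartite graph, then some
cluster contains three quarters of the second side: the cluster of the vertex of the first side with
the fewest cut pairs. -/
theorem exists_majority_label {S : Finset α} (hS : S.Nonempty) (T : Finset β)
    (h : 4 * ((S ×ˢ T).filter fun p => f p.1 ≠ g p.2).card ≤ S.card * T.card) :
    ∃ L, 3 * T.card ≤ 4 * (T.filter fun t => g t = L).card := by
  have hcard : ((S ×ˢ T).filter fun p => f p.1 ≠ g p.2).card =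
      ∑ s ∈ S, (T.filter fun t => f s ≠ g t).card := by
    rw [Finset.card_filter, Finset.sum_product]
    exact Finset.sum_congr rfl fun s _ => (Finset.card_filter _ _).symm
  obtain ⟨s, -, hs⟩ : ∃ s ∈ S, 4 * (T.filter fun t => f s ≠ g t).card ≤ T.card := by
    refine Finset.exists_le_of_sum_le hS ?_
    rw [← Finset.mul_sum, ← hcard]
    simpa using h
  refine ⟨f s, ?_⟩
  have := Finset.card_filter_add_card_filter_not (s := T) fun t => g t = f s
  have h2 : (T.filter fun t => ¬ g t = f s) = T.filter fun t => f s ≠ g t :=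
    Finset.filter_congr fun t _ => by rw [ne_comm]
  rw [h2] at this
  omega

/-- Every vertex outside a cluster that contains most of the other side has many cut pairs. -/
theorem card_outside_majority_le {S : Finset α} {T : Finset β} {L : κ}
    (hL : 3 * T.card ≤ 4 * (T.filter fun t => g t = L).card) :
    3 * T.card * (S.filter fun s => f s ≠ L).card ≤
      4 * ((S ×ˢ T).filter fun p => f p.1 ≠ g p.2).card := by
  have hsub : (S.filter fun s => f s ≠ L) ×ˢ (T.filter fun t => g t = L) ⊆
      (S ×ˢ T).filter fun p => f p.1 ≠ g p.2 := by
    intro p hp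
    simp only [Finset.mem_product, Finset.mem_filter] at hp ⊢
    exact ⟨⟨hp.1.1, hp.2.1⟩, by rw [hp.2.2]; exact hp.1.2⟩
  have := Finset.card_le_card hsub
  rw [Finset.card_product] at this
  nlinarith

end Bipartite

/-! ### The hard graphs -/

/-- The vertices of the hard graphs. There are `q` blocks; block `i` has two rows `row i a s`
(`s : Bool`) for each `a` and a column `col i b` for each `b`. The vertices `hubX` and `hubY` are the
cores of two clusters, and the vertices `anchor` add volume to the second one. -/
inductive GadgetVertex (q k D : ℕ) : Type
  | row (i : Fin q) (a : Fin k) (s : Bool) : GadgetVertex q k D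
  | col (i : Fin q) (b : Fin k) : GadgetVertex q k D
  | hubX (r : Fin D) : GadgetVertex q k D
  | hubY (r : Fin D) : GadgetVertex q k D
  | anchor (i : Fin q) (b : Fin k) : GadgetVertex q k D

namespace GadgetVertex

variable {q k D : ℕ}

theorem exists_injective {n : ℕ} (h : 4 * (q * k) + 2 * D ≤ n) :
    ∃ e : GadgetVertex q k D → Fin n, Function.Injective e := by
  let f : GadgetVertex q k D →
      ((Fin q × Fin k × Bool) ⊕ (Fin q × Fin k)) ⊕ ((Fin D ⊕ Fin D) ⊕ (Fin q × Fin k)) :=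
    fun v => match v with
    | row i a s => .inl (.inl (i, a, s))
    | col i b => .inl (.inr (i, b))
    | hubX r => .inr (.inl (.inl r))
    | hubY r => .inr (.inl (.inr r))
    | anchor i b => .inr (.inr (i, b))
  have hf : Function.Injective f := by
    intro v w
    cases v <;> cases w <;> simp [f]
  obtain ⟨g⟩ : Nonempty (((Fin q × Fin k × Bool) ⊕ (Fin q × Fin k)) ⊕
      ((Fin D ⊕ Fin D) ⊕ (Fin q × Fin k)) ↪ Fin n) := by
    refine Function.Embedding.nonempty_of_card_le ?_
    simp only [Fintype.card_sum, Fintype.card_prod, Fintype.card_fin, Fintype.card_bool]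
    linarith
  exact ⟨g ∘ f, g.injective.comp hf⟩

/-- The edges that encode the bits `x`: the column `b` of block `i` is joined, for each `a`, to one
of the two rows with number `a`. -/
noncomputable def bitArcs (D : ℕ) (x : Fin q × Fin k × Fin k → Bool) :
    List (GadgetVertex q k D × GadgetVertex q k D) :=
  (Finset.univ : Finset (Fin q × Fin k × Fin k)).toList.map fun t =>
    (row t.1 t.2.1 (x t), col t.1 t.2.2)

/-- The edges that select the rows `row i j false`: these rows and the anchors are completely joined
to `hubY`, and all other rows are completely joined to `hubX`. -/
noncomputable def hubArcs (q D : ℕ) (j : Fin k) :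
    List (GadgetVertex q k D × GadgetVertex q k D) :=
  ((Finset.univ : Finset ((Fin q × Fin k × Bool) × Fin D)).toList.map fun t =>
    (row t.1.1 t.1.2.1 t.1.2.2,
      if t.1.2.1 = j ∧ t.1.2.2 = false then hubY t.2 else hubX t.2)) ++
  (Finset.univ : Finset ((Fin q × Fin k) × Fin D)).toList.map fun t =>
    (anchor t.1.1 t.1.2, hubY t.2)

theorem mem_bitArcs {x : Fin q × Fin k × Fin k → Bool} {p} :
    p ∈ bitArcs D x ↔ ∃ i a b, p = (row i a (x (i, a, b)), col i b) := by
  simp [bitArcs, eq_comm]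

theorem mem_hubArcs {j : Fin k} {p : GadgetVertex q k D × GadgetVertex q k D} :
    p ∈ hubArcs q D j ↔
      (∃ i a s r, p = (row i a s, if a = j ∧ s = false then hubY r else hubX r)) ∨
      ∃ i b r, p = (anchor i b, hubY r) := by
  simp only [hubArcs, List.mem_append, List.mem_map, Finset.mem_toList, Finset.mem_univ, true_and,
    Prod.exists]
  constructor
  · rintro (⟨i, a, s, r, rfl⟩ | ⟨i, b, r, rfl⟩)
    · exact .inl ⟨_, _, _, _, rfl⟩
    · exact .inr ⟨_, _, _, rfl⟩
  · rintro (⟨i, a, s, r, rfl⟩ | ⟨i, b, r, rfl⟩)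
    · exact .inl ⟨_, _, _, _, rfl⟩
    · exact .inr ⟨_, _, _, rfl⟩

theorem length_bitArcs (x : Fin q × Fin k × Fin k → Bool) :
    (bitArcs D x).length = q * (k * k) := by
  simp [bitArcs]

theorem length_hubArcs (j : Fin k) : (hubArcs q D j).length = 3 * (q * k * D) := by
  simp [hubArcs]
  ring

theorem nodup_arcs (x : Fin q × Fin k × Fin k → Bool) (j : Fin k) :
    (bitArcs D x ++ hubArcs q D j).Nodup := by
  refine List.Nodup.append ?_ (List.Nodup.append ?_ ?_ ?_) ?_
  · refine (Finset.nodup_toList _).map ?_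
    rintro ⟨i, a, b⟩ ⟨i', a', b'⟩ h
    simp only [Prod.mk.injEq, row.injEq, col.injEq] at h
    obtain ⟨⟨rfl, rfl, -⟩, -, rfl⟩ := h
    rfl
  · refine (Finset.nodup_toList _).map ?_
    rintro ⟨⟨i, a, s⟩, r⟩ ⟨⟨i', a', s'⟩, r'⟩ h
    simp only [Prod.mk.injEq, row.injEq] at h
    obtain ⟨⟨rfl, rfl, rfl⟩, h⟩ := h
    split_ifs at h <;> simp_all
  · refine (Finset.nodup_toList _).map ?_
    rintro ⟨⟨i, a⟩, r⟩ ⟨⟨i', a'⟩, r'⟩ h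
    simp_all
  · intro p hp hp'
    simp only [List.mem_map, Prod.exists] at hp hp'
    obtain ⟨_, _, _, _, -, rfl⟩ := hp
    obtain ⟨_, _, _, -, h⟩ := hp'
    simp at h
  · intro p hp hp'
    rw [mem_bitArcs] at hp
    obtain ⟨i, a, b, rfl⟩ := hp
    rcases mem_hubArcs.1 hp' with ⟨_, _, _, _, h⟩ | ⟨_, _, _, h⟩
    · simp only [Prod.mk.injEq] at h
      split_ifs at h <;> simp at h
    · simp at h

/-- All edges are directed from the rows and anchors to the columns and hubs. -/
theorem arc_source_target {x : Fin q × Fin k × Fin k → Bool} {j : Fin k}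
    {p p' : GadgetVertex q k D × GadgetVertex q k D} (hp : p ∈ bitArcs D x ++ hubArcs q D j)
    (hp' : p' ∈ bitArcs D x ++ hubArcs q D j) : p.1 ≠ p'.2 := by
  rw [List.mem_append, mem_bitArcs, mem_hubArcs] at hp hp'
  have h2 : ∀ i a s, p'.2 ≠ row i a s ∧ ∀ b, p'.2 ≠ anchor i b := by
    rcases hp' with ⟨_, _, _, rfl⟩ | ⟨_, _, _, _, rfl⟩ | ⟨_, _, _, rfl⟩ <;> intro i a s
    · simp
    · dsimp only
      split_ifs <;> simp
    · simp
  intro heq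
  rcases hp with ⟨_, _, _, rfl⟩ | ⟨_, _, _, _, rfl⟩ | ⟨i, b, _, rfl⟩
  · exact (h2 _ _ _).1 heq.symm
  · exact (h2 _ _ _).1 heq.symm
  · exact (h2 i b true).2 _ heq.symm

variable {n : ℕ} (e : GadgetVertex q k D → Fin n)

/-- The undirected edges on `[n]` given by a list of arcs. -/
def edgeList (l : List (GadgetVertex q k D × GadgetVertex q k D)) : List (Sym2 (Fin n)) :=
  l.map fun p => s(e p.1, e p.2)

/-- The stream of the hard instance with bits `x` and selected row `j`. -/
noncomputable def gadgetEdges (x : Fin q × Fin k × Fin k → Bool) (j : Fin k) :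
    List (Sym2 (Fin n)) :=
  edgeList e (bitArcs D x) ++ edgeList e (hubArcs q D j)

/-- The hard graph with bits `x` and selected row `j`. -/
noncomputable def gadgetGraph (x : Fin q × Fin k × Fin k → Bool) (j : Fin k) :
    SimpleGraph (Fin n) :=
  graphOfList (gadgetEdges e x j)

variable {e} {x : Fin q × Fin k × Fin k → Bool} {j : Fin k}

theorem gadgetEdges_eq : gadgetEdges e x j = edgeList e (bitArcs D x ++ hubArcs q D j) := by
  simp [gadgetEdges, edgeList]

theorem nodup_gadgetEdges (he : Function.Injective e) : (gadgetEdges e x j).Nodup := by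
  rw [gadgetEdges_eq]
  refine List.Nodup.map_on ?_ (nodup_arcs x j)
  intro p hp p' hp' h
  rcases Sym2.eq_iff.1 h with h | h
  · exact Prod.ext (he h.1) (he h.2)
  · exact (arc_source_target hp hp' (he h.1)).elim

theorem not_isDiag_of_mem_gadgetEdges (he : Function.Injective e) :
    ∀ s ∈ gadgetEdges e x j, ¬ s.IsDiag := by
  rw [gadgetEdges_eq]
  intro s hs
  obtain ⟨p, hp, rfl⟩ := List.mem_map.1 hs
  exact fun h => arc_source_target hp hp (he (Sym2.mk_isDiag_iff.1 h))

theorem edgeCount_gadgetGraph_le (hkD : k ≤ D) :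
    edgeCount (gadgetGraph e x j) ≤ 4 * (q * k * D) := by
  refine (edgeCount_graphOfList_le _).trans ?_
  rw [gadgetEdges_eq, edgeList, List.length_map, List.length_append, length_bitArcs,
    length_hubArcs]
  have : q * (k * k) ≤ q * k * D := by
    rw [← mul_assoc]
    exact Nat.mul_le_mul_left _ hkD
  omega

theorem gadgetGraph_adj (he : Function.Injective e) {u v : Fin n} :
    (gadgetGraph e x j).Adj u v ↔ ∃ p ∈ bitArcs D x ++ hubArcs q D j,
      (e p.1 = u ∧ e p.2 = v) ∨ (e p.1 = v ∧ e p.2 = u) := by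
  have h1 : (gadgetGraph e x j).Adj u v ↔ s(u, v) ∈ gadgetEdges e x j := by
    rw [mem_edgeSet_graphOfList (not_isDiag_of_mem_gadgetEdges he), SimpleGraph.mem_edgeSet]
    rfl
  rw [h1, gadgetEdges_eq, edgeList, List.mem_map]
  refine exists_congr fun p => and_congr_right fun _ => ?_
  rw [Sym2.eq_iff]

theorem adj_row_col (he : Function.Injective e) (i : Fin q) (a b : Fin k) :
    (gadgetGraph e x j).Adj (e (row i a (x (i, a, b)))) (e (col i b)) :=
  (gadgetGraph_adj he).2 ⟨_, List.mem_append_left _ (mem_bitArcs.2 ⟨i, a, b, rfl⟩),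
    .inl ⟨rfl, rfl⟩⟩

theorem adj_row_hubX (he : Function.Injective e) (i : Fin q) {a : Fin k} {s : Bool} (r : Fin D)
    (h : ¬ (a = j ∧ s = false)) :
    (gadgetGraph e x j).Adj (e (row i a s)) (e (hubX r)) :=
  (gadgetGraph_adj he).2 ⟨_, List.mem_append_right _
    (mem_hubArcs.2 (.inl ⟨i, a, s, r, rfl⟩)), .inl ⟨rfl, by simp [h]⟩⟩

theorem adj_row_hubY (he : Function.Injective e) (i : Fin q) (r : Fin D) :
    (gadgetGraph e x j).Adj (e (row i j false)) (e (hubY r)) :=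
  (gadgetGraph_adj he).2 ⟨_, List.mem_append_right _
    (mem_hubArcs.2 (.inl ⟨i, j, false, r, rfl⟩)), .inl ⟨rfl, by simp⟩⟩

theorem adj_anchor_hubY (he : Function.Injective e) (i : Fin q) (b : Fin k) (r : Fin D) :
    (gadgetGraph e x j).Adj (e (anchor i b)) (e (hubY r)) :=
  (gadgetGraph_adj he).2 ⟨_, List.mem_append_right _
    (mem_hubArcs.2 (.inr ⟨i, b, r, rfl⟩)), .inl ⟨rfl, rfl⟩⟩

theorem eq_row_of_adj_col (he : Function.Injective e) {i : Fin q} {b : Fin k} {w : Fin n}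
    (h : (gadgetGraph e x j).Adj (e (col i b)) w) : ∃ a, w = e (row i a (x (i, a, b))) := by
  obtain ⟨p, hp, h⟩ := (gadgetGraph_adj he).1 h
  rw [List.mem_append, mem_bitArcs, mem_hubArcs] at hp
  rcases hp with ⟨i', a', b', rfl⟩ | ⟨i', a', s', r', rfl⟩ | ⟨i', b', r', rfl⟩
  · rcases h with ⟨h, -⟩ | ⟨h1, h2⟩
    · simpa using he h
    · have := he h2
      simp only [col.injEq] at this
      obtain ⟨rfl, rfl⟩ := this
      exact ⟨a', h1.symm⟩
  · rcases h with ⟨h, -⟩ | ⟨-, h⟩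
    · simpa using he h
    · have := he h
      split_ifs at this
  · rcases h with ⟨h, -⟩ | ⟨-, h⟩
    · simpa using he h
    · simpa using he h

/-- The side of the selected rows: these rows, `hubY` and the anchors. -/
def IsSelectedSide (j : Fin k) : GadgetVertex q k D → Prop
  | row _ a s => a = j ∧ s = false
  | col _ _ => False
  | hubX _ => False
  | hubY _ => True
  | anchor _ _ => True

/-- The edges that leave the side of the selected rows join these rows to columns. -/
theorem eq_row_col_of_adj (he : Function.Injective e) {u v : Fin n}
    (h : (gadgetGraph e x j).Adj u v) (hu : ∃ w, e w = u ∧ IsSelectedSide j w)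
    (hv : ¬ ∃ w, e w = v ∧ IsSelectedSide j w) :
    ∃ i b, u = e (row i j false) ∧ v = e (col i b) := by
  obtain ⟨p, hp, h⟩ := (gadgetGraph_adj he).1 h
  obtain ⟨w, rfl, hw⟩ := hu
  rw [List.mem_append, mem_bitArcs, mem_hubArcs] at hp
  rcases h with ⟨h1, rfl⟩ | ⟨rfl, h1⟩
  · rw [← he h1] at hw
    rcases hp with ⟨i', a', b', rfl⟩ | ⟨i', a', s', r', rfl⟩ | ⟨i', b', r', rfl⟩
    · obtain ⟨rfl, hx⟩ := hw
      exact ⟨i', b', by rw [← h1, hx], rfl⟩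
    · exact (hv ⟨_, rfl, by simp only [if_pos (show a' = j ∧ s' = false from hw), IsSelectedSide]⟩).elim
    · exact (hv ⟨_, rfl, trivial⟩).elim
  · rw [← he h1] at hw
    rcases hp with ⟨i', a', b', rfl⟩ | ⟨i', a', s', r', rfl⟩ | ⟨i', b', r', rfl⟩
    · exact hw.elim
    · refine (hv ⟨_, rfl, ?_⟩).elim
      by_contra hne
      have hne' : ¬ (a' = j ∧ s' = false) := hne
      simp only [if_neg hne', IsSelectedSide] at hw
    · exact (hv ⟨_, rfl, trivial⟩).elim

end GadgetVertex

/-! ### Two-level decompositions of the hard graphs -/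

namespace GadgetVertex

section Analysis

variable {q k D n : ℕ} {e : GadgetVertex q k D → Fin n} {x : Fin q × Fin k × Fin k → Bool}
  {j : Fin k} {ε φ : ℝ} {P : VertexPartition n}

theorem card_le_card_crossingPairs {ι : Type} {G : SimpleGraph (Fin n)} (S : Finset ι)
    (f : ι → Fin n × Fin n) (hf : Function.Injective f)
    (h : ∀ s ∈ S, G.Adj (f s).1 (f s).2 ∧ P.part (f s).1 ≠ P.part (f s).2) :
    S.card ≤ (crossingPairs G P).card :=
  Finset.card_le_card_of_injOn f (fun s hs => mem_crossingPairs.2 (h s hs)) hf.injOn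

/-- Most of `hubX` is in one cluster, and most rows that are not selected are in that cluster. -/
theorem exists_cluster_hubX (he : Function.Injective e) (hq : 0 < q) (hk : 0 < k)
    (hF : 4 * (crossingPairs (gadgetGraph e x j) P).card ≤ q * k * D) :
    ∃ L, 3 * D ≤ 4 * (Finset.univ.filter fun r : Fin D => P.part (e (hubX r)) = L).card ∧
      3 * D * (Finset.univ.filter fun t : Fin q × Fin k × Bool =>
          ¬ (t.2.1 = j ∧ t.2.2 = false) ∧ P.part (e (row t.1 t.2.1 t.2.2)) ≠ L).card ≤
        4 * (crossingPairs (gadgetGraph e x j) P).card := by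
  classical
  let S : Finset (Fin q × Fin k × Bool) := Finset.univ.filter fun t => ¬ (t.2.1 = j ∧ t.2.2 = false)
  let T : Finset (Fin q × Fin k × Bool) := Finset.univ.filter fun t => t.2.2 = true
  have hTS : T ⊆ S := fun t ht => by
    have : t.2.2 = true := by simpa [T] using ht
    simp [S, this]
  have hT : q * k ≤ T.card := by
    have : ((Finset.univ : Finset (Fin q × Fin k)).card) ≤ T.card :=
      Finset.card_le_card_of_injOn (fun t => (t.1, t.2, true)) (fun t _ => by simp [T])
        (fun t _ t' _ h => by simpa [Prod.ext_iff] using h)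
    simpa using this
  have hcross : ((S ×ˢ (Finset.univ : Finset (Fin D))).filter fun p =>
      P.part (e (row p.1.1 p.1.2.1 p.1.2.2)) ≠ P.part (e (hubX p.2))).card ≤
      (crossingPairs (gadgetGraph e x j) P).card := by
    refine card_le_card_crossingPairs _
      (fun p => (e (row p.1.1 p.1.2.1 p.1.2.2), e (hubX p.2))) ?_ ?_
    · rintro ⟨⟨i, a, s⟩, r⟩ ⟨⟨i', a', s'⟩, r'⟩ h
      have := Prod.ext_iff.1 h
      have h1 := he this.1
      have h2 := he this.2
      simp_all
    · intro p hp
      rw [Finset.mem_filter, Finset.mem_product] at hp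
      have hp1 : ¬ (p.1.2.1 = j ∧ p.1.2.2 = false) := (Finset.mem_filter.1 hp.1.1).2
      exact ⟨adj_row_hubX he _ _ hp1, hp.2⟩
  have hS : S.Nonempty := by
    rw [← Finset.card_pos]
    exact (Nat.mul_pos hq hk).trans_le (hT.trans (Finset.card_le_card hTS))
  obtain ⟨L, hL⟩ := exists_majority_label
    (f := fun t : Fin q × Fin k × Bool => P.part (e (row t.1 t.2.1 t.2.2)))
    (g := fun r : Fin D => P.part (e (hubX r))) hS Finset.univ (by
      refine (Nat.mul_le_mul_left 4 hcross).trans (hF.trans ?_)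
      rw [Finset.card_univ, Fintype.card_fin]
      exact Nat.mul_le_mul_right _ (hT.trans (Finset.card_le_card hTS)))
  have hout := card_outside_majority_le
    (f := fun t : Fin q × Fin k × Bool => P.part (e (row t.1 t.2.1 t.2.2))) (S := S) hL
  rw [Finset.card_univ, Fintype.card_fin] at hL hout
  refine ⟨L, hL, le_trans ?_ (hout.trans (Nat.mul_le_mul_left 4 hcross))⟩
  rw [Finset.filter_filter]

/-- Most of `hubY` is in one cluster, and most anchors and selected rows are in that cluster. -/
theorem exists_cluster_hubY (he : Function.Injective e) (hq : 0 < q) (hk : 0 < k)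
    (hF : 4 * (crossingPairs (gadgetGraph e x j) P).card ≤ q * k * D) :
    ∃ L, 3 * D ≤ 4 * (Finset.univ.filter fun r : Fin D => P.part (e (hubY r)) = L).card ∧
      3 * D * (Finset.univ.filter fun t : Fin q × Fin k =>
          P.part (e (anchor t.1 t.2)) ≠ L).card ≤
        4 * (crossingPairs (gadgetGraph e x j) P).card ∧
      3 * D * (Finset.univ.filter fun i : Fin q => P.part (e (row i j false)) ≠ L).card ≤
        4 * (crossingPairs (gadgetGraph e x j) P).card := by
  classical
  have hcross : (((Finset.univ : Finset (Fin q × Fin k)) ×ˢ (Finset.univ : Finset (Fin D))).filter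
      fun p => P.part (e (anchor p.1.1 p.1.2)) ≠ P.part (e (hubY p.2))).card ≤
      (crossingPairs (gadgetGraph e x j) P).card := by
    refine card_le_card_crossingPairs _ (fun p => (e (anchor p.1.1 p.1.2), e (hubY p.2))) ?_ ?_
    · rintro ⟨⟨i, a⟩, r⟩ ⟨⟨i', a'⟩, r'⟩ h
      have := Prod.ext_iff.1 h
      have h1 := he this.1
      have h2 := he this.2
      simp_all
    · intro p hp
      exact ⟨adj_anchor_hubY he _ _ _, (Finset.mem_filter.1 hp).2⟩
  have hcross' : (((Finset.univ : Finset (Fin q)) ×ˢ (Finset.univ : Finset (Fin D))).filter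
      fun p => P.part (e (row p.1 j false)) ≠ P.part (e (hubY p.2))).card ≤
      (crossingPairs (gadgetGraph e x j) P).card := by
    refine card_le_card_crossingPairs _ (fun p => (e (row p.1 j false), e (hubY p.2))) ?_ ?_
    · rintro ⟨i, r⟩ ⟨i', r'⟩ h
      have := Prod.ext_iff.1 h
      have h1 := he this.1
      have h2 := he this.2
      simp_all
    · intro p hp
      exact ⟨adj_row_hubY he _ _, (Finset.mem_filter.1 hp).2⟩
  obtain ⟨L, hL⟩ := exists_majority_label (f := fun t : Fin q × Fin k => P.part (e (anchor t.1 t.2)))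
    (g := fun r : Fin D => P.part (e (hubY r))) ⟨(⟨0, hq⟩, ⟨0, hk⟩), Finset.mem_univ _⟩
    Finset.univ (by
      refine (Nat.mul_le_mul_left 4 hcross).trans (hF.trans ?_)
      simp)
  have hout := card_outside_majority_le
    (f := fun t : Fin q × Fin k => P.part (e (anchor t.1 t.2))) (S := Finset.univ) hL
  have hout' := card_outside_majority_le
    (f := fun i : Fin q => P.part (e (row i j false))) (S := Finset.univ) hL
  rw [Finset.card_univ, Fintype.card_fin] at hL hout hout'
  exact ⟨L, hL, hout.trans (Nat.mul_le_mul_left 4 hcross),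
    hout'.trans (Nat.mul_le_mul_left 4 hcross')⟩

/-- The two hubs cannot share a cluster: the side of the selected rows would be a sparse cut of it,
as only the edges of the selected rows to the columns cross. -/
theorem cluster_hubX_ne_cluster_hubY (he : Function.Injective e) (hq : 0 < q) (hk : 0 < k)
    (hD : 0 < D) (hφ : 0 < φ) (hφD : 3 ≤ φ * D)
    (hP : IsExpanderDecomposition (gadgetGraph e x j) ε φ P)
    (hF : 8 * (crossingPairs (gadgetGraph e x j) P).card ≤ 3 * (q * k * D))
    {L L' : Finset (Fin n)}
    (hL : 3 * D ≤ 4 * (Finset.univ.filter fun r : Fin D => P.part (e (hubX r)) = L).card)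
    (hL1 : 3 * D * (Finset.univ.filter fun t : Fin q × Fin k × Bool =>
          ¬ (t.2.1 = j ∧ t.2.2 = false) ∧ P.part (e (row t.1 t.2.1 t.2.2)) ≠ L).card ≤
        4 * (crossingPairs (gadgetGraph e x j) P).card)
    (hL' : 3 * D ≤ 4 * (Finset.univ.filter fun r : Fin D => P.part (e (hubY r)) = L').card)
    (hL1' : 3 * D * (Finset.univ.filter fun t : Fin q × Fin k =>
          P.part (e (anchor t.1 t.2)) ≠ L').card ≤
        4 * (crossingPairs (gadgetGraph e x j) P).card) : L ≠ L' := by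
  classical
  rintro rfl
  -- More than half of the anchors, and of the rows `row i a true`, are in the common cluster.
  have hanchor : q * k ≤ 2 * (Finset.univ.filter fun t : Fin q × Fin k =>
      P.part (e (anchor t.1 t.2)) = L).card := by
    have := Finset.card_filter_add_card_filter_not (s := (Finset.univ : Finset (Fin q × Fin k)))
      fun t => P.part (e (anchor t.1 t.2)) = L
    rw [Finset.card_univ, Fintype.card_prod, Fintype.card_fin, Fintype.card_fin] at this
    simp only [ne_eq] at hL1'
    have h2 : 2 * (Finset.univ.filter fun t : Fin q × Fin k =>
      ¬ P.part (e (anchor t.1 t.2)) = L).card ≤ q * k := by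
      refine Nat.le_of_mul_le_mul_left (c := 3 * D) ?_ (by omega)
      nlinarith
    omega
  have hrow : q * k ≤ 2 * (Finset.univ.filter fun t : Fin q × Fin k =>
      P.part (e (row t.1 t.2 true)) = L).card := by
    have := Finset.card_filter_add_card_filter_not (s := (Finset.univ : Finset (Fin q × Fin k)))
      fun t => P.part (e (row t.1 t.2 true)) = L
    rw [Finset.card_univ, Fintype.card_prod, Fintype.card_fin, Fintype.card_fin] at this
    have h1 : (Finset.univ.filter fun t : Fin q × Fin k =>
        ¬ P.part (e (row t.1 t.2 true)) = L).card ≤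
        (Finset.univ.filter fun t : Fin q × Fin k × Bool =>
          ¬ (t.2.1 = j ∧ t.2.2 = false) ∧ P.part (e (row t.1 t.2.1 t.2.2)) ≠ L).card := by
      refine Finset.card_le_card_of_injOn (fun t => (t.1, t.2, true)) ?_ ?_
      · intro t ht
        simpa using ht
      · intro t _ t' _ h
        simpa [Prod.ext_iff] using h
    have h2 : 2 * (Finset.univ.filter fun t : Fin q × Fin k =>
      ¬ P.part (e (row t.1 t.2 true)) = L).card ≤ q * k := by
      refine Nat.le_of_mul_le_mul_left (c := 3 * D) ?_ (by omega)
      nlinarith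
    omega
  obtain ⟨rY, hrY⟩ : (Finset.univ.filter fun r : Fin D => P.part (e (hubY r)) = L).Nonempty := by
    rw [← Finset.card_pos]
    omega
  obtain ⟨rX, hrX⟩ : (Finset.univ.filter fun r : Fin D => P.part (e (hubX r)) = L).Nonempty := by
    rw [← Finset.card_pos]
    omega
  rw [Finset.mem_filter] at hrX hrY
  have hmem : ∀ {v}, P.part v = L → v ∈ L := fun {v} h => h ▸ P.mem_part (Finset.mem_univ _)
  have hU : L ∈ P.parts := hrX.2 ▸ P.part_mem.2 (Finset.mem_univ _)
  let X : Finset (Fin n × Fin n) := ((Finset.univ.filter fun r : Fin D => P.part (e (hubY r)) = L) ×ˢ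
    (Finset.univ.filter fun t : Fin q × Fin k => P.part (e (anchor t.1 t.2)) = L)).image
      fun p => (e (hubY p.1), e (anchor p.2.1 p.2.2))
  let Y : Finset (Fin n × Fin n) := ((Finset.univ.filter fun r : Fin D => P.part (e (hubX r)) = L) ×ˢ
    (Finset.univ.filter fun t : Fin q × Fin k => P.part (e (row t.1 t.2 true)) = L)).image
      fun p => (e (hubX p.1), e (row p.2.1 p.2.2 true))
  let Z : Finset (Fin n × Fin n) := (Finset.univ : Finset (Fin q × Fin k)).image
    fun p => (e (row p.1 j false), e (col p.1 p.2))
  have hX : 3 * D * (q * k) ≤ 8 * X.card := by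
    rw [Finset.card_image_of_injective, Finset.card_product]
    · nlinarith [Nat.mul_le_mul hL' hanchor]
    · rintro ⟨r, i, a⟩ ⟨r', i', a'⟩ h
      have := Prod.ext_iff.1 h
      have h1 := he this.1
      have h2 := he this.2
      simp_all
  have hY : 3 * D * (q * k) ≤ 8 * Y.card := by
    rw [Finset.card_image_of_injective, Finset.card_product]
    · nlinarith [Nat.mul_le_mul hL hrow]
    · rintro ⟨r, i, a⟩ ⟨r', i', a'⟩ h
      have := Prod.ext_iff.1 h
      have h1 := he this.1
      have h2 := he this.2
      simp_all
  have hZ : Z.card ≤ q * k := Finset.card_image_le.trans (by simp)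
  have hcut := ((hP.expander L hU).cut_induce hφ (fun v => ∃ w, e w = v ∧ IsSelectedSide j w)
    (u := e (hubY rY)) (v := e (hubX rX)) (hmem hrY.2) ⟨_, rfl, trivial⟩ (hmem hrX.2)
    (by rintro ⟨w, hw, hs⟩; rw [he hw] at hs; exact hs) X Y Z ?_ ?_ ?_).1
  · have hXr : (3 * D * (q * k) : ℝ) / 8 ≤ X.card := by
      rw [div_le_iff₀ (by norm_num)]
      exact_mod_cast (by linarith : 3 * D * (q * k) ≤ X.card * 8)
    have hYr : (3 * D * (q * k) : ℝ) / 8 ≤ Y.card := by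
      rw [div_le_iff₀ (by norm_num)]
      exact_mod_cast (by linarith : 3 * D * (q * k) ≤ Y.card * 8)
    have hZr : (Z.card : ℝ) ≤ q * k := by exact_mod_cast hZ
    have h1 : φ * ((3 * D * (q * k) : ℝ) / 8) ≤ q * k :=
      (mul_le_mul_of_nonneg_left (le_min hXr hYr) hφ.le).trans (hcut.trans hZr)
    have hqk : (0 : ℝ) < q * k := by positivity
    nlinarith
  · intro p hp
    obtain ⟨⟨r, t⟩, ht, rfl⟩ := Finset.mem_image.1 hp
    rw [Finset.mem_product, Finset.mem_filter, Finset.mem_filter] at ht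
    exact ⟨hmem ht.1.2, hmem ht.2.2, ⟨_, rfl, trivial⟩, (adj_anchor_hubY he _ _ _).symm⟩
  · intro p hp
    obtain ⟨⟨r, t⟩, ht, rfl⟩ := Finset.mem_image.1 hp
    rw [Finset.mem_product, Finset.mem_filter, Finset.mem_filter] at ht
    refine ⟨hmem ht.1.2, hmem ht.2.2, ?_, (adj_row_hubX he _ _ (by simp)).symm⟩
    rintro ⟨w, hw, hs⟩
    rw [he hw] at hs
    exact hs
  · intro a b _ _ ha hb hab
    obtain ⟨i, b, rfl, rfl⟩ := eq_row_col_of_adj he hab ha hb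
    exact Finset.mem_image.2 ⟨(i, b), Finset.mem_univ _, rfl⟩

open Classical in
/-- The guess for the bit `(i, j, b)`, read off a clustering: `false` if the selected row of block
`i` shares its cluster with the column `b`. -/
noncomputable def decodeBit (e : GadgetVertex q k D → Fin n) (P : VertexPartition n) (j : Fin k)
    (t : Fin q × Fin k) : Bool :=
  if P.part (e (row t.1 j false)) = P.part (e (col t.1 t.2)) then false else true

set_option maxHeartbeats 1000000 in
/-- The second-level clustering determines all but a hundredth of the bits with selected number `j`.
A wrongly decoded column `b` of block `i` has one of four defects: the selected row of the block left
the cluster of `hubY`, a neighbouring row left the cluster of `hubX`, the column itself left the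
cluster of `hubX` and cut `k - 1` edges, or its edge to the selected row is cut at the second
level. -/
theorem card_decodeBit_ne_le (he : Function.Injective e) (hq : 0 < q) (hk : 2 ≤ k) (hkD : k ≤ D)
    (hε : 0 < ε) (hφ : 0 < φ) (hεk : ε * k ≤ 1 / 4400) (hφD : 3 ≤ φ * D)
    (hεD : 3400 * ε * D ≤ k) {P₁ P₂ : VertexPartition n}
    (h₁ : IsExpanderDecomposition (gadgetGraph e x j) ε φ P₁)
    (h₂ : IsExpanderDecomposition (removeIntraCluster (gadgetGraph e x j) P₁) ε φ P₂) :
    ((Finset.univ.filter fun t : Fin q × Fin k => decodeBit e P₂ j t ≠ x (t.1, j, t.2)).card : ℝ) ≤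
      q * k / 100 := by
  classical
  set F : ℕ := (crossingPairs (gadgetGraph e x j) P₁).card with hFdef
  have hk0 : (2 : ℝ) ≤ k := by exact_mod_cast hk
  have hq0 : (0 : ℝ) < q := by exact_mod_cast hq
  have hD0 : (2 : ℝ) ≤ D := by exact_mod_cast hk.trans hkD
  have hF : (F : ℝ) ≤ 8 * ε * (q * k * D) := by
    have h1 := h₁.card_crossingPairs_le
    have h2 : (edgeCount (gadgetGraph e x j) : ℝ) ≤ 4 * (q * k * D) := by
      exact_mod_cast edgeCount_gadgetGraph_le hkD
    nlinarith
  have hε' : ε ≤ 1 / 8800 := by nlinarith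
  have hqkD : (0 : ℝ) < q * k * D := by positivity
  have hF4 : 4 * F ≤ q * k * D := by
    have : (4 * F : ℝ) ≤ q * k * D := by nlinarith
    exact_mod_cast this
  have hF8 : 8 * F ≤ 3 * (q * k * D) := by
    have : (8 * F : ℝ) ≤ 3 * (q * k * D) := by nlinarith
    exact_mod_cast this
  obtain ⟨X, hX, hX1⟩ := exists_cluster_hubX he hq (by omega) hF4
  obtain ⟨Y, hY, hY1, hY2⟩ := exists_cluster_hubY he hq (by omega) hF4
  have hXY : X ≠ Y := cluster_hubX_ne_cluster_hubY he hq (by omega) (by omega) hφ hφD h₁ hF8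
    hX hX1 hY hY1
  let J : Finset (Fin q × Fin k × Bool) := Finset.univ.filter fun t =>
    ¬ (t.2.1 = j ∧ t.2.2 = false) ∧ P₁.part (e (row t.1 t.2.1 t.2.2)) ≠ X
  let J' : Finset (Fin q) := Finset.univ.filter fun i => P₁.part (e (row i j false)) ≠ Y
  let E₁ : Finset (Fin q × Fin k) := J' ×ˢ Finset.univ
  let E₂ : Finset (Fin q × Fin k) := (J ×ˢ (Finset.univ : Finset (Fin k))).image
    fun p => (p.1.1, p.2)
  let E₃ : Finset (Fin q × Fin k) := Finset.univ.filter fun t =>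
    P₁.part (e (col t.1 t.2)) ≠ X ∧
      ∀ a, a ≠ j → P₁.part (e (row t.1 a (x (t.1, a, t.2)))) = X
  let E₄ : Finset (Fin q × Fin k) := Finset.univ.filter fun t =>
    (removeIntraCluster (gadgetGraph e x j) P₁).Adj (e (row t.1 j false)) (e (col t.1 t.2)) ∧
      P₂.part (e (row t.1 j false)) ≠ P₂.part (e (col t.1 t.2))
  have hcover : (Finset.univ.filter fun t : Fin q × Fin k =>
      decodeBit e P₂ j t ≠ x (t.1, j, t.2)) ⊆ E₁ ∪ E₂ ∪ (E₃ ∪ E₄) := by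
    rintro ⟨i, b⟩ ht
    by_contra hnot
    simp only [Finset.mem_union, not_or] at hnot
    obtain ⟨⟨hn1, hn2⟩, hn3, hn4⟩ := hnot
    have hrowY : P₁.part (e (row i j false)) = Y := by
      by_contra h
      exact hn1 (Finset.mem_product.2 ⟨Finset.mem_filter.2 ⟨Finset.mem_univ _, h⟩,
        Finset.mem_univ _⟩)
    have hrowX : ∀ a, ¬ (a = j ∧ x (i, a, b) = false) →
        P₁.part (e (row i a (x (i, a, b)))) = X := by
      intro a ha
      by_contra h
      exact hn2 (Finset.mem_image.2 ⟨((i, a, x (i, a, b)), b), Finset.mem_product.2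
        ⟨Finset.mem_filter.2 ⟨Finset.mem_univ _, ha, h⟩, Finset.mem_univ _⟩, rfl⟩)
    have hcolX : P₁.part (e (col i b)) = X := by
      by_contra h
      exact hn3 (Finset.mem_filter.2 ⟨Finset.mem_univ _, h, fun a ha =>
        hrowX a fun h' => ha h'.1⟩)
    have hdec := (Finset.mem_filter.1 ht).2
    cases hx : x (i, j, b) with
    | false =>
      have hadj : (gadgetGraph e x j).Adj (e (row i j false)) (e (col i b)) := by
        have := adj_row_col (x := x) (j := j) he i j b
        rwa [hx] at this
      have hsame : P₂.part (e (row i j false)) = P₂.part (e (col i b)) := by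
        by_contra h
        refine hn4 (Finset.mem_filter.2 ⟨Finset.mem_univ _, removeIntraCluster_adj.2
          ⟨hadj, ?_⟩, h⟩)
        rw [hrowY, hcolX]
        exact hXY.symm
      apply hdec
      simp only [decodeBit, hsame, if_true, hx]
    | true =>
      have hiso : ∀ w, ¬ (removeIntraCluster (gadgetGraph e x j) P₁).Adj (e (col i b)) w := by
        intro w hw
        obtain ⟨hadj, hne⟩ := removeIntraCluster_adj.1 hw
        obtain ⟨a, rfl⟩ := eq_row_of_adj_col he hadj
        apply hne
        rw [hcolX, hrowX a]
        rintro ⟨rfl, h⟩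
        rw [hx] at h
        exact Bool.noConfusion h
      have hne := h₂.part_ne_of_isolated hφ (v := e (row i j false)) (u := e (col i b))
        (fun h => by simpa using he h) hiso
      apply hdec
      simp only [decodeBit, hne, if_false, hx]
  have hE₁ : (E₁.card : ℝ) ≤ q * k / 400 := by
    have h1 : E₁.card = J'.card * k := by simp [E₁, Finset.card_product]
    have h2 : (3 * D * J'.card : ℝ) ≤ 4 * F := by exact_mod_cast hY2
    have h3 : (J'.card : ℝ) ≤ q / 400 := by
      refine le_of_mul_le_mul_left (a := (3 * D : ℝ)) ?_ (by positivity)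
      nlinarith [mul_le_mul_of_nonneg_right hεk (by positivity : (0 : ℝ) ≤ q * D)]
    rw [h1]
    push_cast
    nlinarith
  have hE₂ : (E₂.card : ℝ) ≤ q * k / 400 := by
    have h1 : E₂.card ≤ J.card * k := Finset.card_image_le.trans (by simp [Finset.card_product])
    have h1' : (E₂.card : ℝ) ≤ J.card * k := by exact_mod_cast h1
    have h2 : (3 * D * J.card : ℝ) ≤ 4 * F := by exact_mod_cast hX1
    have h3 : (J.card : ℝ) ≤ q / 400 := by
      refine le_of_mul_le_mul_left (a := (3 * D : ℝ)) ?_ (by positivity)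
      nlinarith [mul_le_mul_of_nonneg_right hεk (by positivity : (0 : ℝ) ≤ q * D)]
    nlinarith
  have hE₃ : (E₃.card : ℝ) ≤ 16 * ε * (q * D) := by
    have h1 : E₃.card * (k - 1) ≤ F := by
      have : (E₃ ×ˢ (Finset.univ.erase j)).card ≤ F := by
        refine card_le_card_crossingPairs _
          (fun p => (e (col p.1.1 p.1.2), e (row p.1.1 p.2 (x (p.1.1, p.2, p.1.2))))) ?_ ?_
        · rintro ⟨⟨i, b⟩, a⟩ ⟨⟨i', b'⟩, a'⟩ h
          have := Prod.ext_iff.1 h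
          have h1 := he this.1
          have h2 := he this.2
          simp_all
        · intro p hp
          obtain ⟨hp1, hp2⟩ := Finset.mem_product.1 hp
          obtain ⟨-, hp3, hp4⟩ := Finset.mem_filter.1 hp1
          refine ⟨(adj_row_col he _ _ _).symm, ?_⟩
          dsimp only
          rw [hp4 _ (Finset.ne_of_mem_erase hp2)]
          exact hp3
      simpa [Finset.card_product, Finset.card_erase_of_mem] using this
    have h2 : (E₃.card * (k - 1) : ℝ) ≤ F := by
      have : ((k - 1 : ℕ) : ℝ) = k - 1 := by
        rw [Nat.cast_sub (by omega), Nat.cast_one]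
      rw [← this]
      exact_mod_cast h1
    have h3 : (E₃.card : ℝ) * (k / 2) ≤ E₃.card * (k - 1) := by
      gcongr
      linarith
    refine le_of_mul_le_mul_right (a := (k / 2 : ℝ)) ?_ (by positivity)
    calc (E₃.card : ℝ) * (k / 2) ≤ 8 * ε * (q * k * D) := h3.trans (h2.trans hF)
      _ = _ := by ring
  have hE₄ : (E₄.card : ℝ) ≤ ε * (q * D) := by
    have h1 : E₄.card ≤
        (crossingPairs (removeIntraCluster (gadgetGraph e x j) P₁) P₂).card := by
      refine card_le_card_crossingPairs _ (fun p => (e (row p.1 j false), e (col p.1 p.2))) ?_ ?_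
      · rintro ⟨i, b⟩ ⟨i', b'⟩ h
        have := Prod.ext_iff.1 h
        have h2 := he this.2
        simp_all
      · intro p hp
        exact (Finset.mem_filter.1 hp).2
    have h2 := h₂.card_crossingPairs_le
    have h3 : (2 * edgeCount (removeIntraCluster (gadgetGraph e x j) P₁) : ℝ) = F := by
      exact_mod_cast two_mul_edgeCount_removeIntraCluster
    have h4 : (E₄.card : ℝ) ≤ ε * F := by
      have : (E₄.card : ℝ) ≤
        (crossingPairs (removeIntraCluster (gadgetGraph e x j) P₁) P₂).card := by exact_mod_cast h1
      rw [← h3]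
      linarith
    have h5 : ε * F ≤ ε * (8 * ε * (q * k * D)) := by gcongr
    have h6 : 8 * (ε * k) ≤ 1 := by linarith
    have h7 : 0 ≤ ε * (q * D) := by positivity
    nlinarith [mul_le_mul_of_nonneg_right h6 h7]
  have hsum := Finset.card_le_card hcover
  have h1 := Finset.card_union_le (E₁ ∪ E₂) (E₃ ∪ E₄)
  have h2 := Finset.card_union_le E₁ E₂
  have h3 := Finset.card_union_le E₃ E₄
  have htot : ((Finset.univ.filter fun t : Fin q × Fin k =>
      decodeBit e P₂ j t ≠ x (t.1, j, t.2)).card : ℝ) ≤ E₁.card + E₂.card + (E₃.card + E₄.card) := by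
    exact_mod_cast (by omega : (Finset.univ.filter fun t : Fin q × Fin k =>
      decodeBit e P₂ j t ≠ x (t.1, j, t.2)).card ≤ E₁.card + E₂.card + (E₃.card + E₄.card))
  have h4 : 17 * ε * (q * D) ≤ q * k / 200 := by nlinarith
  nlinarith

end Analysis

end GadgetVertex

/-! ### Fixing the random bits of a streaming algorithm -/

namespace StreamingAlgorithm

variable {n ℓ L : ℕ} {Ω : Type} [MeasurableSpace Ω] (A : StreamingAlgorithm n ℓ L Ω)

theorem runFrom_append (ω : Ω) (us vs : List (EdgeUpdate n)) (t : ℕ) (s : Fin L → Bool) :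
    A.runFrom ω t s (us ++ vs) = A.runFrom ω (t + us.length) (A.runFrom ω t s us) vs := by
  induction us generalizing t s with
  | nil => rfl
  | cons u us ih =>
    simp only [List.cons_append, runFrom, ih, List.length_cons]
    congr 1
    omega

theorem runFrom_measurable (us : List (EdgeUpdate n)) (t : ℕ) (f : Ω → Fin L → Bool)
    (hf : ∀ s, MeasurableSet {ω | f ω = s}) (s' : Fin L → Bool) :
    MeasurableSet {ω | A.runFrom ω t (f ω) us = s'} := by
  induction us generalizing t f with
  | nil => exact hf s'
  | cons u us ih =>
    refine ih (t + 1) (fun ω => A.step ω t (f ω) u) fun s => ?_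
    have : {ω | A.step ω t (f ω) u = s} = ⋃ r, {ω | f ω = r} ∩ {ω | A.step ω t r u = s} := by
      ext ω
      simp
    rw [this]
    exact MeasurableSet.iUnion fun r => (hf r).inter (A.step_measurable t r u s)

theorem result_measurable (stream : List (EdgeUpdate n)) (S : Set (Fin ℓ → VertexPartition n)) :
    MeasurableSet {ω | A.result ω stream ∈ S} := by
  have : {ω | A.result ω stream ∈ S} = ⋃ s, {ω | A.runFrom ω 0 (A.init ω) stream = s} ∩
      ⋃ P ∈ S, {ω | A.output ω s = P} := by
    ext ω
    simp [result]
  rw [this]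
  refine MeasurableSet.iUnion fun s => (A.runFrom_measurable _ _ _ A.init_measurable s).inter ?_
  exact MeasurableSet.biUnion S.to_countable fun P _ => A.output_measurable s P

open Classical in
/-- For every finite family of instances there are random bits with which the algorithm is correct
on nine tenths of the family. -/
theorem ComputesRED.exists_seed {A : StreamingAlgorithm n ℓ L Ω} {μ : MeasureTheory.Measure Ω}
    [MeasureTheory.IsProbabilityMeasure μ] {ε φ : ℝ} (h : A.ComputesRED μ ε φ) {ι : Type}
    [Fintype ι] (es : ι → List (Sym2 (Fin n))) (hnodup : ∀ i, (es i).Nodup)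
    (hdiag : ∀ i, ∀ e ∈ es i, ¬ e.IsDiag) :
    ∃ ω, (9 / 10 : ℝ) * Fintype.card ι ≤ (Finset.univ.filter fun i =>
      IsRED (graphOfList (es i)) ε φ
        (A.result ω ((es i).map EdgeUpdate.insertion))).card := by
  let S : ι → Set Ω := fun i => {ω | IsRED (graphOfList (es i)) ε φ
        (A.result ω ((es i).map EdgeUpdate.insertion))}
  have hS : ∀ i, MeasurableSet (S i) := fun i =>
    A.result_measurable _ {P | IsRED (graphOfList (es i)) ε φ P}
  have hint : ∀ i, MeasureTheory.Integrable ((S i).indicator (1 : Ω → ℝ)) μ := fun i =>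
    (MeasureTheory.integrable_const (1 : ℝ)).indicator (hS i)
  obtain ⟨ω, hω⟩ := MeasureTheory.exists_integral_le (μ := μ)
    (f := fun ω => ∑ i, (S i).indicator (1 : Ω → ℝ) ω)
    (MeasureTheory.integrable_finsetSum _ fun i _ => hint i)
  refine ⟨ω, ?_⟩
  rw [MeasureTheory.integral_finsetSum _ fun i _ => hint i] at hω
  have h1 : (9 / 10 : ℝ) * Fintype.card ι ≤
      ∑ i, ∫ a, (S i).indicator (1 : Ω → ℝ) a ∂μ := by
    rw [mul_comm, ← nsmul_eq_mul, ← Finset.card_univ]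
    refine Finset.card_nsmul_le_sum _ _ _ fun i _ => ?_
    rw [MeasureTheory.integral_indicator_one (hS i)]
    exact h _ _ (hnodup i) (mem_edgeSet_graphOfList (hdiag i))
  refine h1.trans (hω.trans (le_of_eq ?_))
  rw [Finset.card_filter]
  push_cast
  refine Finset.sum_congr rfl fun i _ => ?_
  simp [Set.indicator_apply, S]

end StreamingAlgorithm

/-! ### Counting bit strings -/

section Coding

variable {I : Type} [Fintype I] [DecidableEq I]

/-- A Hamming ball of relative radius `1/5` has at most `2 ^ (4 / 5 * |I|)` points. The proof bounds
the indicator of the ball by an exponential moment: the numbers `4 ^ (-dist)` sum to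
`(5 / 4) ^ |I|`, and `(5 / 4) ^ 5 * 4 ≤ 2 ^ 4`. -/
theorem card_hammingBall_pow_le (d : I → Bool) :
    (Finset.univ.filter fun x : I → Bool =>
      5 * (Finset.univ.filter fun i => d i ≠ x i).card ≤ Fintype.card I).card ^ 5 ≤
      2 ^ (4 * Fintype.card I) := by
  set M := Fintype.card I
  set B := Finset.univ.filter fun x : I → Bool =>
      5 * (Finset.univ.filter fun i => d i ≠ x i).card ≤ M with hB
  have hsum : ∑ x : I → Bool, (1 / 4 : ℝ) ^ (Finset.univ.filter fun i => d i ≠ x i).card =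
      (5 / 4) ^ M := by
    have h1 := Finset.prod_univ_sum (fun _ : I => (Finset.univ : Finset Bool))
      (fun i b => if d i ≠ b then (1 / 4 : ℝ) else 1)
    have h2 : ∀ i, ∑ b : Bool, (if d i ≠ b then (1 / 4 : ℝ) else 1) = 5 / 4 := by
      intro i
      cases d i <;> norm_num
    rw [Fintype.piFinset_univ] at h1
    simp only [h2, Finset.prod_const, Finset.card_univ] at h1
    rw [h1]
    refine Finset.sum_congr rfl fun x _ => ?_
    rw [Finset.prod_ite]
    simp
  have hball : (B.card : ℝ) * (1 / 4 : ℝ) ^ (M / 5) ≤ (5 / 4) ^ M := by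
    rw [← hsum, ← nsmul_eq_mul]
    refine (Finset.card_nsmul_le_sum B _ _ ?_).trans
      (Finset.sum_le_sum_of_subset_of_nonneg (Finset.subset_univ B) fun _ _ _ => by positivity)
    intro x hx
    refine pow_le_pow_of_le_one (by norm_num) (by norm_num) ?_
    have := (Finset.mem_filter.1 hx).2
    omega
  have h5 : (B.card : ℝ) ^ 5 * (1 / 4 : ℝ) ^ M ≤ ((5 / 4) ^ 5) ^ M := by
    calc (B.card : ℝ) ^ 5 * (1 / 4 : ℝ) ^ M
        ≤ (B.card : ℝ) ^ 5 * (1 / 4 : ℝ) ^ (M / 5 * 5) := by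
          gcongr _ * ?_
          exact pow_le_pow_of_le_one (by norm_num) (by norm_num) (Nat.div_mul_le_self _ _)
      _ = ((B.card : ℝ) * (1 / 4 : ℝ) ^ (M / 5)) ^ 5 := by
          rw [mul_pow, pow_mul]
      _ ≤ ((5 / 4) ^ M) ^ 5 := by gcongr
      _ = _ := by rw [← pow_mul, ← pow_mul, mul_comm]
  have h6 : (B.card : ℝ) ^ 5 ≤ (2 : ℝ) ^ (4 * M) := by
    have h7 : (B.card : ℝ) ^ 5 = (B.card : ℝ) ^ 5 * (1 / 4 : ℝ) ^ M * 4 ^ M := by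
      rw [mul_assoc, ← mul_pow]
      norm_num
    rw [h7]
    calc (B.card : ℝ) ^ 5 * (1 / 4 : ℝ) ^ M * 4 ^ M ≤ ((5 / 4) ^ 5) ^ M * 4 ^ M := by gcongr
      _ = ((5 / 4) ^ 5 * 4) ^ M := by rw [mul_pow]
      _ ≤ (2 ^ 4) ^ M := by gcongr; norm_num
      _ = _ := by rw [← pow_mul]
  exact_mod_cast h6

/-- An encoding of bit strings into `L` bits, from which a decoder recovers all but `11%` of the bits
on average, has `L ≥ |I| / 5 - 2`. -/
theorem card_le_of_average_errors {L : ℕ} (enc : (I → Bool) → Fin L → Bool)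
    (dec : (Fin L → Bool) → I → Bool)
    (h : (∑ x : I → Bool, ((Finset.univ.filter fun i => dec (enc x) i ≠ x i).card : ℝ)) ≤
      11 / 100 * Fintype.card I * 2 ^ Fintype.card I) :
    Fintype.card I ≤ 5 * L + 10 := by
  set M := Fintype.card I with hM
  rcases Nat.eq_zero_or_pos M with h0 | h0
  · omega
  have hM0 : (0 : ℝ) < M := by exact_mod_cast h0
  let good : Finset (I → Bool) := Finset.univ.filter fun x =>
    5 * (Finset.univ.filter fun i => dec (enc x) i ≠ x i).card ≤ M
  -- By Markov's inequality, at least a quarter of the strings have at most `M / 5` errors.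
  have hgood : (2 : ℝ) ^ M ≤ 4 * good.card := by
    have h1 : ((goodᶜ).card : ℝ) * (M / 5) ≤ 11 / 100 * M * 2 ^ M := by
      rw [← nsmul_eq_mul]
      refine le_trans ?_ h
      refine (Finset.card_nsmul_le_sum goodᶜ _ _ ?_).trans
        (Finset.sum_le_sum_of_subset_of_nonneg (Finset.subset_univ _) fun _ _ _ => by positivity)
      intro x hx
      have hx' : ¬ 5 * (Finset.univ.filter fun i => dec (enc x) i ≠ x i).card ≤ M := by
        simpa [good] using hx
      rw [div_le_iff₀ (by norm_num)]
      exact_mod_cast (by omega : M ≤ (Finset.univ.filter fun i => dec (enc x) i ≠ x i).card * 5)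
    have h2 : ((goodᶜ).card : ℝ) ≤ 55 / 100 * 2 ^ M := by
      refine le_of_mul_le_mul_right (a := (M / 5 : ℝ)) ?_ (by positivity)
      linarith
    have h3 : (good.card : ℝ) + (goodᶜ).card = 2 ^ M := by
      have := Finset.card_add_card_compl good
      rw [Fintype.card_fun, Fintype.card_bool] at this
      exact_mod_cast this
    have : (0 : ℝ) < 2 ^ M := by positivity
    linarith
  -- The good strings are covered by the Hamming balls around the `2 ^ L` decoded strings.
  have hcover : ∃ m : Fin L → Bool, good.card ≤ 2 ^ L * (Finset.univ.filter fun x : I → Bool =>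
      5 * (Finset.univ.filter fun i => dec m i ≠ x i).card ≤ M).card := by
    by_contra hno
    push Not at hno
    have h1 : good.card ≤ ∑ m : Fin L → Bool, (Finset.univ.filter fun x : I → Bool =>
        5 * (Finset.univ.filter fun i => dec m i ≠ x i).card ≤ M).card := by
      refine le_trans (Finset.card_le_card ?_) (Finset.card_biUnion_le (s := Finset.univ))
      intro x hx
      exact Finset.mem_biUnion.2 ⟨enc x, Finset.mem_univ _, Finset.mem_filter.2
        ⟨Finset.mem_univ _, (Finset.mem_filter.1 hx).2⟩⟩
    have h2 : ∑ m : Fin L → Bool, 2 ^ L * (Finset.univ.filter fun x : I → Bool =>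
        5 * (Finset.univ.filter fun i => dec m i ≠ x i).card ≤ M).card <
        ∑ _m : Fin L → Bool, good.card :=
      Finset.sum_lt_sum_of_nonempty ⟨fun _ => false, Finset.mem_univ _⟩ fun m _ => hno m
    rw [← Finset.mul_sum, Finset.sum_const, Finset.card_univ, Fintype.card_fun, Fintype.card_bool,
      Fintype.card_fin, smul_eq_mul] at h2
    exact absurd (Nat.lt_of_mul_lt_mul_left h2) (not_lt.2 h1)
  obtain ⟨m, hm⟩ := hcover
  have hball := card_hammingBall_pow_le (dec m)
  have h1 : (2 ^ M) ^ 5 ≤ 2 ^ (10 + 5 * L + 4 * M) := by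
    have h2 : 2 ^ M ≤ 4 * good.card := by exact_mod_cast hgood
    calc (2 ^ M) ^ 5 ≤ (4 * (2 ^ L * (Finset.univ.filter fun x : I → Bool =>
          5 * (Finset.univ.filter fun i => dec m i ≠ x i).card ≤ M).card)) ^ 5 :=
          Nat.pow_le_pow_left (h2.trans (Nat.mul_le_mul_left 4 hm)) 5
      _ = 2 ^ (10 + 5 * L) * (Finset.univ.filter fun x : I → Bool =>
          5 * (Finset.univ.filter fun i => dec m i ≠ x i).card ≤ M).card ^ 5 := by
          rw [mul_pow, mul_pow, ← pow_mul, pow_add, mul_comm L 5]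
          ring
      _ ≤ 2 ^ (10 + 5 * L) * 2 ^ (4 * M) := Nat.mul_le_mul_left _ hball
      _ = _ := by rw [← pow_add]
  rw [← pow_mul] at h1
  have := (Nat.pow_le_pow_iff_right (by norm_num : 1 < 2)).1 h1
  omega

/-- An encoding of bit strings into `L` bits, from which a decoder recovers, for half of the strings,
`r` of the bits without error, has `L ≥ r - 1`. -/
theorem le_of_partial_decoding {L r : ℕ} (enc : (I → Bool) → Fin L → Bool)
    (known : (Fin L → Bool) → Finset I) (dec : (Fin L → Bool) → I → Bool)
    (S : Finset (I → Bool)) (hS : 2 ^ Fintype.card I ≤ 2 * S.card)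
    (h : ∀ x ∈ S, r ≤ (known (enc x)).card ∧ ∀ i ∈ known (enc x), x i = dec (enc x) i) :
    r ≤ L + 1 := by
  set M := Fintype.card I with hM
  have hfib : ∀ m : Fin L → Bool, (Finset.univ.filter fun x : I → Bool =>
      r ≤ (known m).card ∧ ∀ i ∈ known m, x i = dec m i).card ≤ 2 ^ (M - r) := by
    intro m
    by_cases hr : r ≤ (known m).card
    · let t : I → Finset Bool := fun i => if i ∈ known m then {dec m i} else Finset.univ
      have hsub : (Finset.univ.filter fun x : I → Bool =>
          r ≤ (known m).card ∧ ∀ i ∈ known m, x i = dec m i) ⊆ Fintype.piFinset t := by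
        intro x hx
        have hx' := (Finset.mem_filter.1 hx).2.2
        rw [Fintype.mem_piFinset]
        intro i
        by_cases hi : i ∈ known m
        · simp [t, hi, hx' i hi]
        · simp [t, hi]
      refine (Finset.card_le_card hsub).trans ?_
      rw [Fintype.card_piFinset]
      have : ∀ i, (t i).card = if i ∈ known m then 1 else 2 := by
        intro i
        by_cases hi : i ∈ known m <;> simp [t, hi]
      simp only [this, Finset.prod_ite, Finset.prod_const, one_pow, one_mul]
      refine Nat.pow_le_pow_right (by norm_num) ?_
      have := Finset.card_filter_add_card_filter_not (s := (Finset.univ : Finset I))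
        fun i => i ∈ known m
      rw [Finset.card_univ, Finset.filter_mem_eq_inter, Finset.univ_inter] at this
      omega
    · rw [Finset.filter_false_of_mem (fun x _ hx => hr hx.1)]
      exact Nat.zero_le _
  have hcov : S.card ≤ 2 ^ L * 2 ^ (M - r) := by
    have h1 : S.card ≤ ∑ m : Fin L → Bool, (Finset.univ.filter fun x : I → Bool =>
        r ≤ (known m).card ∧ ∀ i ∈ known m, x i = dec m i).card := by
      refine le_trans (Finset.card_le_card ?_) (Finset.card_biUnion_le (s := Finset.univ))
      intro x hx
      exact Finset.mem_biUnion.2 ⟨enc x, Finset.mem_univ _, Finset.mem_filter.2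
        ⟨Finset.mem_univ _, h x hx⟩⟩
    refine h1.trans ((Finset.sum_le_sum fun m _ => hfib m).trans ?_)
    simp
  have hrM : r ≤ M := by
    have hpos : 0 < S.card := by
      have : 0 < 2 ^ M := by positivity
      omega
    obtain ⟨x, hx⟩ := Finset.card_pos.1 hpos
    exact (h x hx).1.trans (Finset.card_le_univ _)
  have h2 : 2 ^ M ≤ 2 ^ (1 + L + (M - r)) := by
    refine hS.trans ((Nat.mul_le_mul_left 2 hcov).trans (le_of_eq ?_))
    rw [pow_add, pow_add]
    ring
  have := (Nat.pow_le_pow_iff_right (by norm_num : 1 < 2)).1 h2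
  omega

end Coding

/-! ### The memory needed for the hard graphs -/

theorem REDComputableWithBits.mono {n ℓ L : ℕ} {ε φ ε' φ' : ℝ}
    (h : REDComputableWithBits n ℓ L ε φ) (hε : ε ≤ ε') (hφ : φ' ≤ φ) :
    REDComputableWithBits n ℓ L ε' φ' := by
  obtain ⟨Ω, _, μ, _, A, hA⟩ := h
  exact ⟨Ω, _, μ, inferInstance, A, fun G es hes hG => (hA G es hes hG).trans
    (MeasureTheory.measureReal_mono fun ω hω => hω.mono hε hφ)⟩

open GadgetVertex in
/-- The reduction from indexing: after the edges that encode `q * k * k` bits, the memory allows to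
recover, for each `j`, almost all bits `(i, j, b)`, by continuing the stream with the edges that
select the rows `row i j false`. -/
theorem card_bits_le_of_computable {n ℓ L q k D : ℕ} {ε φ : ℝ} (hℓ : 2 ≤ ℓ) (hq : 0 < q)
    (hk : 2 ≤ k) (hkD : k ≤ D) (hε : 0 < ε) (hφ : 0 < φ) (hεk : ε * k ≤ 1 / 4400)
    (hφD : 3 ≤ φ * D) (hεD : 3400 * ε * D ≤ k) (hn : 4 * (q * k) + 2 * D ≤ n)
    (h : REDComputableWithBits n ℓ L ε φ) : q * (k * k) ≤ 5 * L + 10 := by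
  classical
  obtain ⟨Ω, _, μ, _, A, hA⟩ := h
  obtain ⟨e, he⟩ := GadgetVertex.exists_injective hn
  obtain ⟨ω, hω⟩ := hA.exists_seed
    (fun p : (Fin q × Fin k × Fin k → Bool) × Fin k => gadgetEdges e p.1 p.2)
    (fun p => nodup_gadgetEdges he) (fun p => not_isDiag_of_mem_gadgetEdges he)
  set good : Finset ((Fin q × Fin k × Fin k → Bool) × Fin k) := Finset.univ.filter fun p =>
      IsRED (graphOfList (gadgetEdges e p.1 p.2)) ε φ
        (A.result ω ((gadgetEdges e p.1 p.2).map EdgeUpdate.insertion)) with hgood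
  let enc : (Fin q × Fin k × Fin k → Bool) → Fin L → Bool := fun x =>
    A.runFrom ω 0 (A.init ω) ((edgeList e (bitArcs D x)).map EdgeUpdate.insertion)
  let fin : (Fin L → Bool) → Fin k → Fin ℓ → VertexPartition n := fun m j =>
    A.output ω (A.runFrom ω (q * (k * k)) m
      ((edgeList e (hubArcs q D j)).map EdgeUpdate.insertion))
  have hfin : ∀ x j, A.result ω ((gadgetEdges e x j).map EdgeUpdate.insertion) =
      fin (enc x) j := by
    intro x j
    simp only [StreamingAlgorithm.result, gadgetEdges, List.map_append, A.runFrom_append, fin, enc]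
    congr 2
    simp [edgeList, length_bitArcs]
  let dec : (Fin L → Bool) → Fin q × Fin k × Fin k → Bool := fun m t =>
    decodeBit e (fin m t.2.1 ⟨1, by omega⟩) t.2.1 (t.1, t.2.2)
  let err : (Fin q × Fin k × Fin k → Bool) → Fin k → ℕ := fun x j =>
    (Finset.univ.filter fun t : Fin q × Fin k =>
      decodeBit e (fin (enc x) j ⟨1, by omega⟩) j t ≠ x (t.1, j, t.2)).card
  have herr : ∀ x, (Finset.univ.filter fun t => dec (enc x) t ≠ x t).card = ∑ j, err x j := by
    intro x
    rw [Finset.card_eq_sum_card_fiberwise (f := fun t => t.2.1) (t := Finset.univ)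
      (fun _ _ => Finset.mem_coe.2 (Finset.mem_univ _))]
    refine Finset.sum_congr rfl fun j _ => ?_
    refine Finset.card_nbij' (fun t => (t.1, t.2.2)) (fun t => (t.1, j, t.2)) ?_ ?_ ?_ ?_
    · rintro ⟨i, a, b⟩ ht
      simp only [Finset.coe_filter, Finset.mem_filter, Finset.mem_univ, true_and,
        Set.mem_ofPred_eq] at ht ⊢
      obtain ⟨ht, rfl⟩ := ht
      exact ht
    · rintro ⟨i, b⟩ ht
      simp only [Finset.coe_filter, Finset.mem_filter, Finset.mem_univ, true_and,
        Set.mem_ofPred_eq] at ht ⊢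
      exact ⟨ht, trivial⟩
    · rintro ⟨i, a, b⟩ ht
      simp only [Finset.coe_filter, Finset.mem_filter, Finset.mem_univ, true_and,
        Set.mem_ofPred_eq] at ht
      obtain ⟨-, rfl⟩ := ht
      rfl
    · rintro ⟨i, b⟩ _
      rfl
  have hbound : ∀ p : (Fin q × Fin k × Fin k → Bool) × Fin k,
      (err p.1 p.2 : ℝ) ≤ q * k / 100 + (if p ∈ good then (0 : ℝ) else q * k) := by
    rintro ⟨x, j⟩
    by_cases hp : (x, j) ∈ good
    · have hred : IsRED (gadgetGraph e x j) ε φ (fin (enc x) j) := by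
        rw [← hfin]
        exact (Finset.mem_filter.1 hp).2
      rw [if_pos hp, add_zero]
      exact card_decodeBit_ne_le he hq hk hkD hε hφ hεk hφD hεD
        (hred.first (by omega)) (hred.second (by omega))
    · have h1 : err x j ≤ q * k := (Finset.card_le_univ _).trans (by simp)
      have h2 : (err x j : ℝ) ≤ q * k := by exact_mod_cast h1
      rw [if_neg hp]
      have : (0 : ℝ) ≤ q * k / 100 := by positivity
      linarith
  set M := Fintype.card (Fin q × Fin k × Fin k) with hM
  have hMval : M = q * (k * k) := by simp [hM]
  have hcard : Fintype.card ((Fin q × Fin k × Fin k → Bool) × Fin k) = 2 ^ M * k := by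
    rw [Fintype.card_prod, Fintype.card_fun, Fintype.card_bool, Fintype.card_fin]
  rw [← hMval]
  refine card_le_of_average_errors enc dec ?_
  rw [← hM]
  calc ∑ x, ((Finset.univ.filter fun t => dec (enc x) t ≠ x t).card : ℝ)
      = ∑ p : (Fin q × Fin k × Fin k → Bool) × Fin k, (err p.1 p.2 : ℝ) := by
        rw [Fintype.sum_prod_type]
        refine Finset.sum_congr rfl fun x _ => ?_
        rw [herr]
        push_cast
        rfl
    _ ≤ ∑ p : (Fin q × Fin k × Fin k → Bool) × Fin k,
          ((q * k / 100 : ℝ) + (if p ∈ good then (0 : ℝ) else q * k)) :=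
        Finset.sum_le_sum fun p _ => hbound p
    _ = (2 ^ M * k) * (q * k / 100) + (goodᶜ).card * (q * k) := by
        rw [Finset.sum_add_distrib, Finset.sum_const, Finset.card_univ, hcard, nsmul_eq_mul,
          Finset.sum_ite, Finset.sum_const_zero, zero_add, Finset.sum_const, nsmul_eq_mul]
        have : (Finset.univ.filter fun p => p ∉ good) = goodᶜ := by
          ext p
          simp
        rw [this]
        push_cast
        rfl
    _ ≤ (2 ^ M * k) * (q * k / 100) + (1 / 10 * (2 ^ M * k)) * (q * k) := by
        have h1 := Finset.card_add_card_compl good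
        rw [hcard] at h1
        have h2 : (good.card : ℝ) + (goodᶜ).card = 2 ^ M * k := by exact_mod_cast h1
        rw [hcard] at hω
        push_cast at hω
        gcongr
        linarith
    _ = 11 / 100 * M * 2 ^ M := by
        rw [hMval]
        push_cast
        ring

/-- The choice of parameters: `k ≈ 1 / ε` rows per block, `q ≈ n / k` blocks and hubs of size
`D ≈ 1 / φ`. -/
theorem bits_ge_of_computable {n ℓ L : ℕ} {ε φ : ℝ} (hℓ : 2 ≤ ℓ) (hε : 0 < ε) (hφ : 0 < φ)
    (hφε : φ ≤ ε) (hεφ : 10 ^ 9 * ε ^ 2 ≤ φ) (hnφ : 10 ^ 9 ≤ φ * n)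
    (h : REDComputableWithBits n ℓ L ε φ) : 1 / 1408000 * (n / ε) ≤ (L : ℝ) := by
  have hε9 : 10 ^ 9 * ε ≤ 1 := by
    refine le_of_mul_le_mul_right (a := ε) ?_ hε
    nlinarith
  have hφ9 : 10 ^ 9 * φ ≤ 1 := by linarith
  have hn0 : (0 : ℝ) ≤ n := Nat.cast_nonneg n
  have hφ1 : φ ≤ 1 := by linarith
  obtain ⟨k, hkdef⟩ : ∃ k, k = ⌊1 / (4400 * ε)⌋₊ := ⟨_, rfl⟩
  obtain ⟨D, hDdef⟩ : ∃ D, D = ⌈3 / φ⌉₊ := ⟨_, rfl⟩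
  have hk1 : ε * k ≤ 1 / 4400 := by
    have h1 : (k : ℝ) ≤ 1 / (4400 * ε) := by
      rw [hkdef]
      exact Nat.floor_le (by positivity)
    rw [le_div_iff₀ (by positivity)] at h1
    linarith
  have hk2 : 1 ≤ 8800 * (ε * k) := by
    have h1 : 1 / (4400 * ε) < (k : ℝ) + 1 := by
      rw [hkdef]
      exact Nat.lt_floor_add_one _
    rw [div_lt_iff₀ (by positivity)] at h1
    linarith
  have hk3 : 2 ≤ k := by
    rw [hkdef]
    refine Nat.le_floor ?_
    rw [le_div_iff₀ (by positivity)]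
    push_cast
    linarith
  have hD1 : 3 ≤ φ * D := by
    have h1 : 3 / φ ≤ (D : ℝ) := by
      rw [hDdef]
      exact Nat.le_ceil _
    rw [div_le_iff₀ hφ] at h1
    linarith
  have hD2 : φ * D ≤ 4 := by
    have h1 : (D : ℝ) < 3 / φ + 1 := by
      rw [hDdef]
      exact Nat.ceil_lt_add_one (by positivity)
    have h2 : φ * D < φ * (3 / φ + 1) := by gcongr
    have h3 : φ * (3 / φ + 1) = 3 + φ := by field_simp
    linarith
  have hφk : φ * k ≤ 1 / 4400 := le_trans (by gcongr) hk1
  have hkD : k ≤ D := by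
    have : (k : ℝ) ≤ D := by
      refine le_of_mul_le_mul_left (a := φ) ?_ hφ
      linarith
    exact_mod_cast this
  have hεD : 3400 * ε * D ≤ k := by
    refine le_of_mul_le_mul_left (a := φ) ?_ hφ
    have h1 : φ * (3400 * ε * D) ≤ 13600 * ε := by nlinarith
    have h2 : 10 ^ 9 * ε ^ 2 * k ≤ φ * k := by gcongr
    have h3 : 10 ^ 9 * ε ^ 2 * k = 10 ^ 9 * ε * (ε * k) := by ring
    nlinarith
  have h8k : 8 * k ≤ n := by
    have : (8 * k : ℝ) ≤ n := by
      refine le_of_mul_le_mul_left (a := φ) ?_ hφ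
      linarith
    exact_mod_cast this
  have h4D : 4 * D ≤ n := by
    have : (4 * D : ℝ) ≤ n := by
      refine le_of_mul_le_mul_left (a := φ) ?_ hφ
      linarith
    exact_mod_cast this
  obtain ⟨q, hqdef⟩ : ∃ q, q = n / (8 * k) := ⟨_, rfl⟩
  have hq : 0 < q := by
    rw [hqdef]
    exact Nat.div_pos h8k (by omega)
  have hq1 : 8 * (q * k) ≤ n := by
    have := Nat.div_mul_le_self n (8 * k)
    rw [← hqdef] at this
    linarith
  have hq2 : n ≤ 16 * (q * k) := by
    have := Nat.lt_div_mul_add (a := n) (b := 8 * k) (by omega)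
    rw [← hqdef] at this
    nlinarith
  have hM := card_bits_le_of_computable hℓ hq hk3 hkD hε hφ hk1 hD1 hεD (by omega) h
  have hMr : (q * (k * k) : ℝ) ≤ 5 * L + 10 := by exact_mod_cast hM
  have hq2r : (n : ℝ) ≤ 16 * (q * k) := by exact_mod_cast hq2
  have hk3r : (2 : ℝ) ≤ k := by exact_mod_cast hk3
  have hnr : (10 ^ 9 : ℝ) ≤ n := by nlinarith
  have hM1 : (n : ℝ) * k / 16 ≤ q * (k * k) := by nlinarith
  have hM2 : n / ε / 8800 ≤ (n : ℝ) * k := by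
    rw [div_div, div_le_iff₀ (by positivity)]
    nlinarith
  have hM3 : (20 : ℝ) ≤ n * k / 16 := by nlinarith
  linarith

/-! ### A linear lower bound from matchings -/

/-- The edges of the matching that joins `(i, none)` to `(i, some (x i))` for all `i`. -/
noncomputable def matchingEdges {n N : ℕ} (e : Fin N × Option Bool → Fin n) (x : Fin N → Bool) :
    List (Sym2 (Fin n)) :=
  (Finset.univ : Finset (Fin N)).toList.map fun i => s(e (i, none), e (i, some (x i)))

section Matching

variable {n N : ℕ} {e : Fin N × Option Bool → Fin n} {x : Fin N → Bool}

theorem mem_matchingEdges {s : Sym2 (Fin n)} :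
    s ∈ matchingEdges e x ↔ ∃ i, s = s(e (i, none), e (i, some (x i))) := by
  simp [matchingEdges, eq_comm]

theorem nodup_matchingEdges (he : Function.Injective e) : (matchingEdges e x).Nodup := by
  refine (Finset.nodup_toList _).map fun i i' h => ?_
  rcases Sym2.eq_iff.1 h with h | h
  · exact (Prod.ext_iff.1 (he h.1)).1
  · exact (Prod.ext_iff.1 (he h.1)).1

theorem not_isDiag_of_mem_matchingEdges (he : Function.Injective e) :
    ∀ s ∈ matchingEdges e x, ¬ s.IsDiag := by
  intro s hs h
  obtain ⟨i, rfl⟩ := mem_matchingEdges.1 hs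
  simpa using he (Sym2.mk_isDiag_iff.1 h)

theorem matching_adj (he : Function.Injective e) {u v : Fin n} :
    (graphOfList (matchingEdges e x)).Adj u v ↔
      ∃ i, s(u, v) = s(e (i, none), e (i, some (x i))) := by
  rw [← mem_matchingEdges, mem_edgeSet_graphOfList (not_isDiag_of_mem_matchingEdges he),
    SimpleGraph.mem_edgeSet]

/-- Every edge inside a cluster determines a bit, as the vertex `(i, some s)` with `s ≠ x i` is
isolated. -/
theorem matching_bit_eq_of_part_eq (he : Function.Injective e) {ε φ : ℝ} (hφ : 0 < φ) {P : VertexPartition n}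
    (hP : IsExpanderDecomposition (graphOfList (matchingEdges e x)) ε φ P) {i : Fin N} {s : Bool}
    (h : P.part (e (i, none)) = P.part (e (i, some s))) : x i = s := by
  by_contra hne
  refine hP.part_ne_of_isolated hφ (u := e (i, some s)) (v := e (i, none))
    (fun h => by simpa using he h) ?_ h
  intro w hw
  obtain ⟨i', h'⟩ := (matching_adj he).1 hw
  rcases Sym2.eq_iff.1 h' with h' | h'
  · simpa using he h'.1
  · have := he h'.1
    simp only [Prod.mk.injEq, Option.some.injEq] at this
    obtain ⟨rfl, rfl⟩ := this
    exact hne rfl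

open Classical in
/-- At least a `δ` fraction of the edges of the matching lie inside clusters. -/
theorem matching_card_known_ge (he : Function.Injective e) {ε φ δ : ℝ} (hε : 0 ≤ ε) (hεδ : ε ≤ 1 - δ)
    {P : VertexPartition n}
    (hP : IsExpanderDecomposition (graphOfList (matchingEdges e x)) ε φ P) :
    δ * N ≤ (Finset.univ.filter fun i : Fin N =>
      ∃ s, P.part (e (i, none)) = P.part (e (i, some s))).card := by
  set K := Finset.univ.filter fun i : Fin N =>
      ∃ s, P.part (e (i, none)) = P.part (e (i, some s)) with hK
  have hcut : (Kᶜ ×ˢ (Finset.univ : Finset Bool)).card ≤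
      (crossingPairs (graphOfList (matchingEdges e x)) P).card := by
    refine GadgetVertex.card_le_card_crossingPairs _ (fun p => if p.2 then
      (e (p.1, none), e (p.1, some (x p.1))) else (e (p.1, some (x p.1)), e (p.1, none))) ?_ ?_
    · rintro ⟨i, s⟩ ⟨i', s'⟩ h
      cases s <;> cases s' <;> simp [he.eq_iff] at h ⊢ <;> tauto
    · rintro ⟨i, s⟩ hi
      have hi' : P.part (e (i, none)) ≠ P.part (e (i, some (x i))) := by
        have h1 := (Finset.mem_product.1 hi).1
        rw [Finset.mem_compl, hK, Finset.mem_filter] at h1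
        exact fun h => h1 ⟨Finset.mem_univ _, _, h⟩
      cases s
      · exact ⟨(matching_adj he).2 ⟨i, Sym2.eq_swap⟩, hi'.symm⟩
      · exact ⟨(matching_adj he).2 ⟨i, rfl⟩, hi'⟩
  have h1 : ((Kᶜ).card * 2 : ℝ) ≤
      (crossingPairs (graphOfList (matchingEdges e x)) P).card := by
    rw [Finset.card_product] at hcut
    exact_mod_cast hcut
  have h2 := hP.card_crossingPairs_le
  have h3 : (edgeCount (graphOfList (matchingEdges e x)) : ℝ) ≤ N := by
    have := edgeCount_graphOfList_le (matchingEdges e x)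
    have hlen : (matchingEdges e x).length = N := by simp [matchingEdges]
    rw [hlen] at this
    exact_mod_cast this
  have h4 : (K.card : ℝ) + (Kᶜ).card = N := by
    have := Finset.card_add_card_compl K
    rw [Fintype.card_fin] at this
    exact_mod_cast this
  have h5 : 2 * ε * edgeCount (graphOfList (matchingEdges e x)) ≤ 2 * ε * N := by gcongr
  have h6 : ε * N ≤ (1 - δ) * N := by gcongr
  linarith

end Matching

/-- On a matching, the first level already gives away a `δ` fraction of the edges. -/
theorem matching_bits_le_of_computable {n ℓ L N : ℕ} {ε φ δ : ℝ} (hℓ : 0 < ℓ) (hε : 0 ≤ ε)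
    (hφ : 0 < φ) (hεδ : ε ≤ 1 - δ) (hN : 3 * N ≤ n) (h : REDComputableWithBits n ℓ L ε φ) :
    δ * N ≤ L + 1 := by
  classical
  obtain ⟨Ω, _, μ, _, A, hA⟩ := h
  obtain ⟨e⟩ : Nonempty (Fin N × Option Bool ↪ Fin n) := by
    refine Function.Embedding.nonempty_of_card_le ?_
    simp only [Fintype.card_prod, Fintype.card_option, Fintype.card_bool, Fintype.card_fin]
    omega
  have he := e.injective
  obtain ⟨ω, hω⟩ := hA.exists_seed (fun x : Fin N → Bool => matchingEdges e x)
    (fun x => nodup_matchingEdges he) (fun x => not_isDiag_of_mem_matchingEdges he)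
  rw [Fintype.card_fun, Fintype.card_bool] at hω
  let P : (Fin L → Bool) → VertexPartition n := fun m => A.output ω m ⟨0, hℓ⟩
  have key : ⌈δ * N⌉₊ ≤ L + 1 := by
    refine le_of_partial_decoding (I := Fin N)
      (fun x => A.runFrom ω 0 (A.init ω) ((matchingEdges e x).map EdgeUpdate.insertion))
      (fun m => Finset.univ.filter fun i =>
        ∃ s, (P m).part (e (i, none)) = (P m).part (e (i, some s)))
      (fun m i => decide ((P m).part (e (i, none)) = (P m).part (e (i, some true))))
      (Finset.univ.filter fun x => IsRED (graphOfList (matchingEdges e x)) ε φ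
        (A.result ω ((matchingEdges e x).map EdgeUpdate.insertion))) ?_ ?_
    · push_cast at hω
      have : (0 : ℝ) < 2 ^ Fintype.card (Fin N) := by positivity
      exact_mod_cast (by linarith : (2 : ℝ) ^ Fintype.card (Fin N) ≤
        2 * (Finset.univ.filter fun x => IsRED (graphOfList (matchingEdges e x)) ε φ
          (A.result ω ((matchingEdges e x).map EdgeUpdate.insertion))).card)
    intro x hx
    have hP := IsRED.first (Finset.mem_filter.1 hx).2 hℓ
    refine ⟨Nat.ceil_le.2 ((matching_card_known_ge he hε hεδ hP).trans (le_of_eq ?_)), ?_⟩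
    · congr
    intro i hi
    obtain ⟨s, hs⟩ := (Finset.mem_filter.1 hi).2
    have hxs := matching_bit_eq_of_part_eq he hφ hP hs
    symm
    cases hx' : x i with
    | true =>
      rw [decide_eq_true_iff]
      rw [hx'] at hxs
      rw [hs, ← hxs]
    | false =>
      rw [decide_eq_false_iff_not]
      intro h
      have := matching_bit_eq_of_part_eq he hφ hP h
      rw [hx'] at this
      exact Bool.noConfusion this
  calc δ * N ≤ ⌈δ * N⌉₊ := Nat.le_ceil _
    _ ≤ L + 1 := by exact_mod_cast key

/-! ### The space lower bounds -/

theorem theorem3 :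
    (∃ C : ℝ, 0 < C ∧ ∀ δ : ℝ, 0 < δ → ∃ c : ℝ, 0 < c ∧
      ∀ (n ℓ L : ℕ) (ε φ : ℝ), 1 ≤ n → 2 ≤ ℓ →
        0 < ε → ε < 1 → 0 < φ → φ < 1 →
        ε ≤ 1 - δ → φ ≤ ε → C * max (ε ^ 2) (1 / (n : ℝ)) ≤ φ →
        REDComputableWithBits n ℓ L ε φ →
        c * ((n : ℝ) / ε) ≤ (L : ℝ)) ∧
    (∀ a : ℕ, ∃ b : ℕ, ∀ δ K : ℝ, 0 < δ → 0 < K → ∃ C c : ℝ, 0 < C ∧ 0 < c ∧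
      ∀ (n ℓ L : ℕ) (ε φ : ℝ), 2 ≤ n → 2 ≤ ℓ →
        0 < ε → ε < 1 → 0 < φ → φ < 1 →
        ε ≤ 1 - δ → ε ≤ K * φ * Real.log n ^ a →
        C / (n : ℝ) ≤ φ → φ ≤ 1 / (C * Real.log n) →
        REDComputableWithBits n ℓ L ε φ →
        c * ((n : ℝ) / (φ * Real.log n ^ b)) ≤ (L : ℝ)) := by
  refine ⟨⟨10 ^ 9, by norm_num, fun δ _ => ⟨1 / 1408000, by norm_num, ?_⟩⟩, fun a => ⟨2 * a, ?_⟩⟩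
  · intro n ℓ L ε φ hn hℓ hε _ hφ _ _ hφε hC h
    have hn0 : (0 : ℝ) < n := by exact_mod_cast hn
    refine bits_ge_of_computable hℓ hε hφ hφε ((mul_le_mul_of_nonneg_left (le_max_left _ _)
      (by norm_num)).trans hC) ?_ h
    have := (mul_le_mul_of_nonneg_left (le_max_right (ε ^ 2) (1 / (n : ℝ)))
      (by norm_num : (0 : ℝ) ≤ 10 ^ 9)).trans hC
    rwa [mul_one_div, div_le_iff₀ hn0] at this
  · intro δ K hδ hK
    refine ⟨max (10 ^ 9) (6 * (1 + δ) / δ),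
      min (1 / 1408000 / (K + 1)) (δ / (6 * (10 ^ 9 * K ^ 2))), by positivity, by positivity, ?_⟩
    intro n ℓ L ε φ hn hℓ hε hε1 hφ hφ1 hεδ hεK hCn hCφ h
    set C : ℝ := max (10 ^ 9) (6 * (1 + δ) / δ)
    have hn0 : (0 : ℝ) < n := by
      have : 0 < n := by omega
      exact_mod_cast this
    have hC9 : (10 ^ 9 : ℝ) ≤ C := le_max_left _ _
    have hCδ : 6 * (1 + δ) / δ ≤ C := le_max_right _ _
    have hC0 : 0 < C := by linarith
    rw [div_le_iff₀ hn0] at hCn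
    have hnC : C ≤ n := by nlinarith
    have hlog : 1 ≤ Real.log n := by
      rw [Real.le_log_iff_exp_le hn0]
      have := Real.exp_one_lt_d9
      linarith
    have hφC : C * φ ≤ 1 := by
      have h1 : φ * (C * Real.log n) ≤ 1 := (le_div_iff₀ (by positivity)).1 hCφ
      have h2 : φ * C * 1 ≤ φ * C * Real.log n := by gcongr
      linarith
    have hla : 1 ≤ Real.log n ^ a := one_le_pow₀ hlog
    have hl2 : Real.log n ^ (2 * a) = Real.log n ^ a * Real.log n ^ a := by
      rw [two_mul, pow_add]
    set l : ℝ := Real.log n ^ a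
    rw [hl2]
    have hl0 : 0 < l := by linarith
    by_cases hcase : 10 ^ 9 * max ε φ ^ 2 ≤ φ
    · -- The parameter `ε` may be raised to `max ε φ`.
      have h1 := bits_ge_of_computable hℓ (lt_max_of_lt_left hε) hφ (le_max_right ε φ) hcase
        (hC9.trans hCn) (h.mono (le_max_left ε φ) le_rfl)
      have h2 : max ε φ ≤ (K + 1) * (φ * (l * l)) := by
        have h3 : φ * l ≤ φ * (l * l) := by
          gcongr
          nlinarith
        have h4 : φ ≤ φ * l := by nlinarith
        refine max_le ?_ ?_ <;> nlinarith
      refine le_trans ?_ h1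
      calc min (1 / 1408000 / (K + 1)) (δ / (6 * (10 ^ 9 * K ^ 2))) * (n / (φ * (l * l)))
          ≤ 1 / 1408000 / (K + 1) * (n / (φ * (l * l))) := by
            gcongr
            exact min_le_left _ _
        _ = 1 / 1408000 * (n / ((K + 1) * (φ * (l * l)))) := by
            field_simp
        _ ≤ _ := by
            have : 0 < max ε φ := lt_max_of_lt_left hε
            gcongr
    · -- Here `φ` is at least the inverse of a power of `log n`, and a linear bound suffices.
      have hφε : φ < 10 ^ 9 * ε ^ 2 := by
        rcases le_total ε φ with hle | hle
        · rw [max_eq_right hle] at hcase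
          nlinarith
        · rw [max_eq_left hle] at hcase
          exact not_le.1 hcase
      have h1 : 1 ≤ 10 ^ 9 * K ^ 2 * (φ * (l * l)) := by
        have h2 : ε ^ 2 ≤ (K * φ * l) ^ 2 := by gcongr
        refine le_of_mul_le_mul_left (a := φ) ?_ hφ
        calc φ * 1 ≤ 10 ^ 9 * (K * φ * l) ^ 2 := by linarith
          _ = _ := by ring
      have hN := matching_bits_le_of_computable (N := n / 3) (by omega) hε.le hφ hεδ
        (Nat.mul_div_le n 3) h
      have hN3 : (n : ℝ) / 3 - 1 ≤ (n / 3 : ℕ) := by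
        have : n ≤ 3 * (n / 3) + 3 := by omega
        have : (n : ℝ) ≤ 3 * (n / 3 : ℕ) + 3 := by exact_mod_cast this
        linarith
      have hL : δ / 6 * n ≤ L := by
        have h2 : 6 * (1 + δ) ≤ n * δ := (div_le_iff₀ hδ).1 (hCδ.trans hnC)
        have h3 : δ * (n / 3 - 1) ≤ δ * (n / 3 : ℕ) := by gcongr
        linarith
      refine le_trans ?_ hL
      calc min (1 / 1408000 / (K + 1)) (δ / (6 * (10 ^ 9 * K ^ 2))) * (n / (φ * (l * l)))
          ≤ δ / (6 * (10 ^ 9 * K ^ 2)) * (n / (φ * (l * l))) := by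
            gcongr
            exact min_le_right _ _
        _ = δ / 6 * (n / (10 ^ 9 * K ^ 2 * (φ * (l * l)))) := by
            field_simp
        _ ≤ δ / 6 * n := by
            gcongr
            exact div_le_self hn0.le h1
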